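/- All graphs are finite and simple, and 4-valent means that every vertex has degree 4. A graph $G=(V,E)$ is $k$-vertex-connected if for every $U\subseteq V$ with $|U|<k$ the graph obtained from $G$ by deleting the vertices in $U$ and all edges incident to them is connected (the empty graph counts as connected). For a planar configuration $\mathbf p:V\to\mathbb R^2$ let $r(G(\mathbf p))$ be the rank of the rigidity matrix $R(\mathbf p)$, the $|E|\times 2|V|$ matrix whose row for an edge $\{u,v\}$ has $\mathbf p(u)-\mathbf p(v)$ in the two columns of $u$, $\mathbf p(v)-\mathbf p(u)$ in the two columns of $v$, and $0$ elsewhere. Let $r(G)$ be the value of $r(G(\mathbf q))$ for any generic $\mathbf q$, i.e. one whose $2|V|$ coordinates are algebraically independent over $\mathbb Q$; this value does not depend on the choice of $\mathbf q$. A configuration $\mathbf p$ is in general position if the images of no three distinct vertices lie on one line. Corollary. Let $G=(V,E)$ be a 4-valent graph and $\mathbf p$ a planar configuration of $V$ in general position. (1) If $G$ is 2-vertex-connected, then $r(G)\ge r(G(\mathbf p))\ge \frac85|V|-1$. (2) If $G$ is 3-vertex-connected or 4-vertex-connected, then $r(G)\ge\frac{7|V|-7}{4}$ and $r(G(\mathbf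 p))\ge\frac{5|V|-4}{3}$. (3) The order of all these bounds is sharp, in the following sense: there are arbitrarily large 4-valent 2-vertex-connected graphs $G$ with $r(G)\le\frac85|V|$, and arbitrarily large such $G$ having a configuration $\mathbf p$ in general position with $r(G(\mathbf p))\le\frac85|V|$; and for each $k\in\{3,4\}$ there are arbitrarily large 4-valent $k$-vertex-connected graphs $G$ with $r(G)\le\frac74|V|$, and arbitrarily large 4-valent $k$-vertex-connected graphs $G$ having a configuration $\mathbf p$ in general position with $r(G(\mathbf p))\le\frac53|V|$. -/

import Mathlib

namespace FrameworkRank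

variable {V : Type*}

/-- The simple graph `G` is 4-valent: every vertex has degree 4. -/
def IsFourValent [Fintype V] (G : SimpleGraph V) : Prop :=
  by classical exact G.IsRegularOfDegree 4

/-- `G` is `k`-vertex-connected: deleting any set `U` of fewer than `k` vertices (together with the
edges incident to them) leaves a graph in which any two vertices are joined by a path. As in
`SimpleGraph.IsEdgeConnected`, the empty graph counts as connected. -/
def IsVertexConnected (G : SimpleGraph V) (k : ℕ) : Prop :=
  ∀ U : Finset V, U.card < k → (G.induce {v | v ∉ U}).Preconnected

/-- A planar configuration of the vertex set `V`. -/
abbrev Configuration (V : Type*) : Type _ := V → EuclideanSpace ℝ (Fin 2)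

/-- The images of any three (distinct) vertices do not lie on one line. -/
def InGeneralPosition (p : Configuration V) : Prop :=
  ∀ u v w : V, u ≠ v → u ≠ w → v ≠ w → ¬ Collinear ℝ {p u, p v, p w}

open Classical in
/-- The entry of the rigidity matrix in the row of the edge `e` and the column of the `i`-th
coordinate of the vertex `w`: for `e = {u, v}` it is `p u i - p v i` if `w = u`, it is
`p v i - p u i` if `w = v`, and it is `0` if `w` is not an end of `e`. -/
noncomputable def rigidityEntry (p : Configuration V) (e : Sym2 V) (w : V) (i : Fin 2) : ℝ :=
  Sym2.lift ⟨fun u v => (if w = u then p u i - p v i else 0) + (if w = v then p v i - p u i else 0),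
    fun _ _ => add_comm _ _⟩ e

/-- The rigidity matrix of the framework `G(p)`, of size `|E| × 2|V|`. -/
noncomputable def rigidityMatrix (G : SimpleGraph V) (p : Configuration V) :
    Matrix G.edgeSet (V × Fin 2) ℝ :=
  Matrix.of fun e c => rigidityEntry p e c.1 c.2

/-- The rank `r(G(p))` of the rigidity matrix. -/
noncomputable def rigidityRank [Fintype V] (G : SimpleGraph V) (p : Configuration V) : ℕ :=
  (rigidityMatrix G p).rank

/-- The configuration `p` is generic: its `2|V|` coordinates are algebraically independent
over the rationals. -/
def IsGeneric (p : Configuration V) : Prop :=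
  AlgebraicIndependent ℚ fun c : V × Fin 2 => p c.1 c.2

/-- Generic configurations exist. -/
theorem exists_isGeneric (V : Type*) [Finite V] : ∃ p : Configuration V, IsGeneric p := by
  obtain ⟨s, hs⟩ := exists_isTranscendenceBasis ℚ ℝ
  have hinf : s.Infinite := by
    intro hfin
    have halg := hs.isAlgebraic
    have h1 := Algebra.IsAlgebraic.cardinalMk_le_max (Algebra.adjoin ℚ (Set.range ((↑) : s → ℝ))) ℝ
    have h2 : Cardinal.mk (Algebra.adjoin ℚ (Set.range ((↑) : s → ℝ))) ≤ Cardinal.aleph0 := by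
      rw [← Cardinal.mk_congr hs.1.aevalEquiv.toEquiv]
      have : Countable s := hfin.countable.to_subtype
      refine MvPolynomial.cardinalMk_le_max.trans ?_
      simp
    have h3 := h1.trans (max_le h2 le_rfl)
    rw [Cardinal.mk_real] at h3
    exact absurd h3 (not_le.mpr Cardinal.aleph0_lt_continuum)
  have : Infinite s := hinf.to_subtype
  obtain ⟨n, ⟨e⟩⟩ := Finite.exists_equiv_fin (V × Fin 2)
  let f : V × Fin 2 → s := fun c => Infinite.natEmbedding s (e c)
  have hf : Function.Injective f := fun a b h =>
    e.injective (Fin.val_injective ((Infinite.natEmbedding s).injective h))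
  refine ⟨fun v => WithLp.toLp 2 fun i => (f (v, i) : ℝ), ?_⟩
  exact hs.1.comp f hf

/-- At a generic configuration the rank of the rigidity matrix is as large as possible. -/
theorem IsGeneric.rigidityRank_le [Fintype V] {q : Configuration V} (hq : IsGeneric q)
    (G : SimpleGraph V) (p : Configuration V) : rigidityRank G p ≤ rigidityRank G q := by
  classical
  -- the rigidity matrix with indeterminate coordinates
  let P : Matrix G.edgeSet (V × Fin 2) (MvPolynomial (V × Fin 2) ℚ) := Matrix.of fun e c =>
    Sym2.lift ⟨fun u v =>
      (if c.1 = u then MvPolynomial.X (u, c.2) - MvPolynomial.X (v, c.2) else 0) +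
      (if c.1 = v then MvPolynomial.X (v, c.2) - MvPolynomial.X (u, c.2) else 0),
      fun _ _ => add_comm _ _⟩ e.1
  let φ (r : Configuration V) : MvPolynomial (V × Fin 2) ℚ →ₐ[ℚ] ℝ :=
    MvPolynomial.aeval fun c => r c.1 c.2
  have hP (r : Configuration V) : rigidityMatrix G r = P.map (φ r) := by
    ext ⟨e, he⟩ c
    induction e with
    | h u v =>
      simp only [rigidityMatrix, rigidityEntry, P, φ, Matrix.of_apply, Matrix.map_apply,
        Sym2.lift_mk, map_add]
      split_ifs <;> simp
  obtain ⟨s, hs, hspan, hli⟩ :=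
    exists_linearIndependent ℝ (Set.range (rigidityMatrix G p).row)
  have hsfin : s.Finite := (Set.finite_range _).subset hs
  have : Fintype s := hsfin.fintype
  choose g hg using fun x : s => hs x.2
  have hrow : ((rigidityMatrix G p).submatrix g id).row = ((↑) : s → (V × Fin 2 → ℝ)) := by
    funext x; exact hg x
  have hcard : rigidityRank G p = Fintype.card s := by
    rw [rigidityRank, Matrix.rank_eq_finrank_span_row, ← hspan]
    have h := finrank_span_eq_card hli
    rwa [Subtype.range_coe] at h
  have hsub : ((rigidityMatrix G p).submatrix g id).rank = Fintype.card s :=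
    LinearIndependent.rank_matrix (by rw [hrow]; exact hli)
  let D := ((P.submatrix g id) * (P.submatrix g id).transpose).det
  have hD (r : Configuration V) : (((rigidityMatrix G r).submatrix g id) *
      ((rigidityMatrix G r).submatrix g id).transpose).det = φ r D := by
    rw [hP r, ← AlgHom.coe_toRingHom (φ r)]
    simp only [D, RingHom.map_det, RingHom.mapMatrix_apply, Matrix.map_mul, Matrix.submatrix_map,
      Matrix.transpose_map]
  have hp : φ p D ≠ 0 := by
    rw [← hD p]
    intro h0
    have h1 := Matrix.rank_self_mul_transpose ((rigidityMatrix G p).submatrix g id)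
    rw [hsub] at h1
    have h2 := Matrix.linearIndependent_rows_iff_isUnit (A := ((rigidityMatrix G p).submatrix g id) *
      ((rigidityMatrix G p).submatrix g id).transpose)
    have h3 : LinearIndependent ℝ (((rigidityMatrix G p).submatrix g id) *
      ((rigidityMatrix G p).submatrix g id).transpose).row := by
      rw [linearIndependent_iff_card_eq_finrank_span, Set.finrank,
        ← Matrix.rank_eq_finrank_span_row, h1]
    rw [h2, Matrix.isUnit_iff_isUnit_det, h0] at h3
    exact not_isUnit_zero h3
  have hq0 : φ q D ≠ 0 := by
    intro h0
    have hD0 : D = 0 := hq (by rw [map_zero]; exact h0)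
    exact hp (by rw [hD0, map_zero])
  have h4 : ((rigidityMatrix G q).submatrix g id).rank = Fintype.card s := by
    rw [← Matrix.rank_self_mul_transpose, Matrix.rank_of_det_ne_zero (by rw [hD q]; exact hq0)]
  rw [hcard, ← h4]
  exact Matrix.rank_submatrix_le _ _ _

/-- The rank `r(G)` of the generic rigidity matroid: the rank of the rigidity matrix at a generic
configuration. By `rigidityRank_eq_genericRank` it does not depend on the choice of the latter. -/
noncomputable def genericRank [Fintype V] (G : SimpleGraph V) : ℕ :=
  rigidityRank G (exists_isGeneric V).choose

theorem rigidityRank_eq_genericRank [Fintype V] (G : SimpleGraph V) {q : Configuration V}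
    (hq : IsGeneric q) : rigidityRank G q = genericRank G :=
  le_antisymm ((exists_isGeneric V).choose_spec.rigidityRank_le G q) (hq.rigidityRank_le G _)

end FrameworkRank

/-!
The space of self-stresses of a framework on `n` vertices is the left kernel of its rigidity matrix.
A 4-valent graph has `2 n` edges, so a lower bound on the rank is an upper bound on the dimension of
the space of stresses.

**General position.** A stress is in equilibrium across every cut, and two forces in equilibrium act
along one line; so a stress that is nonzero on at most two edges of a cut vanishes on that cut
(`stress_eq_zero_of_card_cut_le_two`). Hence the stress space splits along cuts of at most two edges,
and a vertex of degree 3 can be deleted at the cost of one dimension. For a 3-edge-connected graph with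
all degrees 3 or 4, not all 4, this gives `3 * dim ≤ h + 3`, where `h` is the number of vertices of
degree 4: after the deletion of a vertex of degree 3 each 3-edge-connected piece of the rest has lost at
least three vertices of degree 4 to the edges that led out of it, which pays for the constant 3 of this
piece (`IsThreeEdgeConnectedOn.three_mul_finrank_stressIn_le`). Starting with a vertex of degree 4, at
the cost of two dimensions, one gets `3 * dim ≤ n + 4` for 3-edge-connected 4-valent graphs; all
3-vertex-connected ones are of this kind. If a connected 4-valent graph is not 3-edge-connected, the
bound for the pieces into which it splits yields `5 * dim ≤ 2 * n`.

**Generic position.** By Laman's theorem, of which only the sufficiency is needed and proved here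
(`IsSparse.stressSpace_eq_bot`), an edge set in which any `k ≥ 2` vertices span at most `2 k - 3` edges
carries no stress. In a 3-edge-connected 4-valent graph a proper vertex set violates this count exactly
if it has at least two vertices and is surrounded by four edges. The minimal such sets are disjoint and
have at least four vertices, or else they are the complements of the single vertices. In both cases the
graph becomes sparse after the deletion of at most `max 3 (n / 4)` edges, and `4 * dim ≤ n + 7` follows.

**Sharpness.** The extremal graphs are rings of blocks. If the blocks are `K₅` minus an edge, with one
link between consecutive blocks, or `K₄`, with two links, moving the `m` blocks rigidly and
independently gives `3 m` degrees of freedom, and each link removes at most one. For a ring of triangles,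
consecutive ones forming prisms, the vertices are placed on a parabola in such a way that the three
links between consecutive triangles are parallel: if the triangles are only translated, these links
impose a single condition.
-/

namespace FrameworkRank

/-! ### Self-stresses -/

section Stress

variable {V : Type*}

theorem rigidityEntry_self (p : Configuration V) (v u : V) (i : Fin 2) :
    rigidityEntry p s(v, u) v i = p v i - p u i := by
  rcases eq_or_ne v u with rfl | h
  · simp [rigidityEntry]
  · simp [rigidityEntry, h]

theorem rigidityEntry_of_notMem (p : Configuration V) {e : Sym2 V} {v : V} (h : v ∉ e)
    (i : Fin 2) : rigidityEntry p e v i = 0 := by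
  induction e with
  | h a b =>
    simp only [Sym2.mem_iff, not_or] at h
    simp [rigidityEntry, h.1, h.2]

variable [Fintype V]

/-- The space of self-stresses of the framework with the edge set `E` and the configuration `p`:
a stress assigns a coefficient to every unordered pair, vanishes off `E`, and is in equilibrium at
every vertex. Loops in `E` are allowed, and carry arbitrary coefficients. -/
def stressSpace (p : Configuration V) (E : Finset (Sym2 V)) : Submodule ℝ (Sym2 V → ℝ) where
  carrier := {ω | (∀ e ∉ E, ω e = 0) ∧ ∀ v i, ∑ u, ω s(v, u) * (p v i - p u i) = 0}
  zero_mem' := by simp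
  add_mem' := by
    rintro a b ⟨ha, ha'⟩ ⟨hb, hb'⟩
    refine ⟨fun e he => by simp [ha e he, hb e he], fun v i => ?_⟩
    simp only [Pi.add_apply, add_mul, Finset.sum_add_distrib, ha', hb', add_zero]
  smul_mem' := by
    rintro c a ⟨ha, ha'⟩
    refine ⟨fun e he => by simp [ha e he], fun v i => ?_⟩
    simp only [Pi.smul_apply, smul_eq_mul, mul_assoc, ← Finset.mul_sum, ha', mul_zero]

open Classical in
theorem sum_mul_rigidityEntry (p : Configuration V) (ω : Sym2 V → ℝ) (v : V) (i : Fin 2) :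
    ∑ e, ω e * rigidityEntry p e v i = ∑ u, ω s(v, u) * (p v i - p u i) := by
  have h1 : ∑ e ∈ Finset.univ.image (fun u => s(v, u)), ω e * rigidityEntry p e v i =
      ∑ e, ω e * rigidityEntry p e v i := by
    refine Finset.sum_subset (Finset.subset_univ _) fun e _ he => ?_
    rw [rigidityEntry_of_notMem, mul_zero]
    intro hv
    obtain ⟨u, rfl⟩ := Sym2.mem_iff_exists.mp hv
    exact he (Finset.mem_image_of_mem _ (Finset.mem_univ u))
  rw [← h1, Finset.sum_image (fun a _ b _ h => Sym2.congr_right.mp h)]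
  exact Finset.sum_congr rfl fun u _ => by rw [rigidityEntry_self]

open Classical in
/-- The self-stresses of a framework form the left kernel of its rigidity matrix. -/
theorem rigidityRank_add_finrank_stressSpace (G : SimpleGraph V) (p : Configuration V) :
    rigidityRank G p + Module.finrank ℝ (stressSpace p G.edgeFinset) = G.edgeFinset.card := by
  let A := (rigidityMatrix G p).transpose
  have key (ω : Sym2 V → ℝ) (h0 : ∀ e ∉ G.edgeFinset, ω e = 0) (v : V) (i : Fin 2) :
      A.mulVec (fun e => ω e.1) (v, i) = ∑ u, ω s(v, u) * (p v i - p u i) := by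
    rw [← sum_mul_rigidityEntry]
    have h2 : ∑ e ∈ G.edgeFinset, ω e * rigidityEntry p e v i =
        ∑ e, ω e * rigidityEntry p e v i :=
      Finset.sum_subset (Finset.subset_univ _) fun e _ he => by rw [h0 e he, zero_mul]
    rw [← h2, Matrix.mulVec, dotProduct]
    simp only [A, Matrix.transpose_apply, rigidityMatrix, Matrix.of_apply]
    rw [Finset.sum_subtype (p := (· ∈ G.edgeSet)) G.edgeFinset
      (fun e => SimpleGraph.mem_edgeFinset)]
    exact Finset.sum_congr rfl fun e _ => mul_comm _ _
  let φ : stressSpace p G.edgeFinset ≃ₗ[ℝ] LinearMap.ker A.mulVecLin :=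
    { toFun := fun ω => ⟨fun e => ω.1 e.1, by
        rw [LinearMap.mem_ker, Matrix.mulVecLin_apply]
        funext c
        exact (key ω.1 ω.2.1 c.1 c.2).trans (ω.2.2 c.1 c.2)⟩
      map_add' := fun a b => rfl
      map_smul' := fun c a => rfl
      invFun := fun x => ⟨fun e => if h : e ∈ G.edgeSet then x.1 ⟨e, h⟩ else 0, by
        have h0 : ∀ e ∉ G.edgeFinset,
            (fun e => if h : e ∈ G.edgeSet then x.1 ⟨e, h⟩ else 0) e = 0 := by
          intro e he
          have : e ∉ G.edgeSet := by simpa using he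
          simp [this]
        refine ⟨h0, fun v i => ?_⟩
        rw [← key _ h0]
        have hx := x.2
        rw [LinearMap.mem_ker, Matrix.mulVecLin_apply] at hx
        exact (congrArg (fun y => A.mulVec y (v, i)) (funext fun e => dif_pos e.2)).trans
          (congrFun hx (v, i))⟩
      left_inv := fun ω => by
        ext e
        by_cases h : e ∈ G.edgeSet
        · simp [h]
        · simp only [h, dite_false]
          exact (ω.2.1 e (by simpa using h)).symm
      right_inv := fun x => by
        ext e
        simp }
  have h3 := LinearMap.finrank_range_add_finrank_ker A.mulVecLin
  rw [Module.finrank_fintype_fun_eq_card] at h3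
  rw [φ.finrank_eq, rigidityRank, ← Matrix.rank_transpose, Matrix.rank, h3,
    SimpleGraph.edgeFinset_card]

/-- If the vanishing of a stress of `E` on the pairs in `T` puts it into the stress space of `E'`,
then the dimension drops by at most the number of those pairs. -/
theorem finrank_stressSpace_le_add_card (p : Configuration V) {E E' : Finset (Sym2 V)}
    (T : Finset (Sym2 V))
    (h : ∀ ω ∈ stressSpace p E, (∀ e ∈ T, ω e = 0) → ω ∈ stressSpace p E') :
    Module.finrank ℝ (stressSpace p E) ≤ Module.finrank ℝ (stressSpace p E') + T.card := by
  let f : stressSpace p E →ₗ[ℝ] (T → ℝ) :=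
    { toFun := fun ω e => ω.1 e.1
      map_add' := fun a b => rfl
      map_smul' := fun c a => rfl }
  have h1 := LinearMap.finrank_range_add_finrank_ker f
  have h2 : Module.finrank ℝ (LinearMap.range f) ≤ T.card :=
    (Submodule.finrank_le _).trans (by simp)
  have h3 : Module.finrank ℝ (LinearMap.ker f) ≤ Module.finrank ℝ (stressSpace p E') := by
    let g : LinearMap.ker f →ₗ[ℝ] stressSpace p E' :=
      { toFun := fun ω => ⟨ω.1.1, h _ ω.1.2 fun e he => congrFun ω.2 ⟨e, he⟩⟩
        map_add' := fun a b => rfl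
        map_smul' := fun c a => rfl }
    refine LinearMap.finrank_le_finrank_of_injective (f := g) fun a b hab => ?_
    exact Subtype.ext (Subtype.ext (congrArg (fun x => x.1) hab))
  omega

/-- If every stress of `E` is the sum of a stress of `E₁` and one of `E₂`, the dimension is
subadditive. -/
theorem finrank_stressSpace_le_add (p : Configuration V) {E E₁ E₂ : Finset (Sym2 V)}
    (h : stressSpace p E ≤ stressSpace p E₁ ⊔ stressSpace p E₂) :
    Module.finrank ℝ (stressSpace p E) ≤
      Module.finrank ℝ (stressSpace p E₁) + Module.finrank ℝ (stressSpace p E₂) :=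
  (Submodule.finrank_mono h).trans (Submodule.finrank_add_le_finrank_add_finrank _ _)

/-! ### Moments and small cuts -/

/-- Twice the signed area of the triangle `z x y`. -/
def area (z x y : EuclideanSpace ℝ (Fin 2)) : ℝ :=
  (x 0 - z 0) * (y 1 - z 1) - (x 1 - z 1) * (y 0 - z 0)

theorem collinear_iff_area_eq_zero (z x y : EuclideanSpace ℝ (Fin 2)) :
    Collinear ℝ {z, x, y} ↔ area z x y = 0 := by
  rw [collinear_iff_of_mem (p₀ := z) (by simp)]
  constructor
  · rintro ⟨d, hd⟩
    obtain ⟨r, rfl⟩ := hd x (by simp)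
    obtain ⟨t, rfl⟩ := hd y (by simp)
    simp [area]
    ring
  · intro h
    by_cases hxz : x = z
    · refine ⟨y - z, ?_⟩
      subst hxz
      simp only [Set.mem_insert_iff, Set.mem_singleton_iff]
      rintro q (rfl | rfl | rfl)
      · exact ⟨0, by simp⟩
      · exact ⟨0, by simp⟩
      · exact ⟨1, by simp⟩
    · refine ⟨x - z, ?_⟩
      have hy : ∃ r : ℝ, y = r • (x - z) +ᵥ z := by
        unfold area at h
        by_cases h0 : x 0 - z 0 = 0
        · have h1 : x 1 - z 1 ≠ 0 := by
            intro h1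
            apply hxz
            ext i
            fin_cases i
            · exact sub_eq_zero.mp h0
            · exact sub_eq_zero.mp h1
          refine ⟨(y 1 - z 1) / (x 1 - z 1), ?_⟩
          have h2 : y 0 - z 0 = 0 := by
            rw [h0, zero_mul, zero_sub, neg_eq_zero] at h
            exact (mul_eq_zero.mp h).resolve_left h1
          ext i
          fin_cases i
          · simp [h0]; linarith
          · simp; field_simp; ring
        · refine ⟨(y 0 - z 0) / (x 0 - z 0), ?_⟩
          ext i
          fin_cases i
          · simp; field_simp; ring
          · simp; field_simp; linarith
      simp only [Set.mem_insert_iff, Set.mem_singleton_iff]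
      rintro q (rfl | rfl | rfl)
      · exact ⟨0, by simp⟩
      · exact ⟨1, by simp⟩
      · exact hy

theorem area_self_left (x y : EuclideanSpace ℝ (Fin 2)) : area x x y = 0 := by simp [area]

theorem area_self_right (x y : EuclideanSpace ℝ (Fin 2)) : area y x y = 0 := by simp [area]

open Classical in
/-- The forces that a stress exerts across a cut have total moment zero about every point. -/
theorem sum_cut_moment {p : Configuration V} {E : Finset (Sym2 V)} {ω : Sym2 V → ℝ}
    (hω : ω ∈ stressSpace p E) (X : Finset V) (z : EuclideanSpace ℝ (Fin 2)) :
    ∑ q ∈ X ×ˢ Xᶜ, ω s(q.1, q.2) * area z (p q.1) (p q.2) = 0 := by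
  have h1 (x : V) : ∑ y, ω s(x, y) * area z (p x) (p y) = 0 := by
    have h0 := hω.2 x 0
    have h1 := hω.2 x 1
    have : ∑ y, ω s(x, y) * area z (p x) (p y) =
        (p x 1 - z 1) * ∑ y, ω s(x, y) * (p x 0 - p y 0) -
        (p x 0 - z 0) * ∑ y, ω s(x, y) * (p x 1 - p y 1) := by
      rw [Finset.mul_sum, Finset.mul_sum, ← Finset.sum_sub_distrib]
      exact Finset.sum_congr rfl fun y _ => by unfold area; ring
    rw [this, h0, h1]; simp
  have h2 : ∑ x ∈ X, ∑ y ∈ X, ω s(x, y) * area z (p x) (p y) = 0 := by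
    have h3 : ∑ x ∈ X, ∑ y ∈ X, ω s(x, y) * area z (p x) (p y) =
        - ∑ x ∈ X, ∑ y ∈ X, ω s(x, y) * area z (p x) (p y) := by
      conv_lhs => rw [Finset.sum_comm]
      simp only [← Finset.sum_neg_distrib]
      refine Finset.sum_congr rfl fun x _ => Finset.sum_congr rfl fun y _ => ?_
      rw [Sym2.eq_swap]; unfold area; ring
    linarith
  rw [Finset.sum_product]
  have h4 : ∑ x ∈ X, ∑ y, ω s(x, y) * area z (p x) (p y) = 0 :=
    Finset.sum_eq_zero fun x _ => h1 x
  have h5 : ∑ x ∈ X, ∑ y, ω s(x, y) * area z (p x) (p y) =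
      ∑ x ∈ X, ∑ y ∈ X, ω s(x, y) * area z (p x) (p y) +
      ∑ x ∈ X, ∑ y ∈ Xᶜ, ω s(x, y) * area z (p x) (p y) := by
    rw [← Finset.sum_add_distrib]
    exact Finset.sum_congr rfl fun x _ => (Finset.sum_add_sum_compl X _).symm
  linarith

open Classical in
/-- In general position a stress that is nonzero on at most two edges of a cut vanishes on the
whole cut: two forces in equilibrium act along the same line. -/
theorem stress_eq_zero_of_card_cut_le_two {p : Configuration V} (hp : InGeneralPosition p)
    (hV : 2 < Fintype.card V) {E : Finset (Sym2 V)} {ω : Sym2 V → ℝ} (hω : ω ∈ stressSpace p E)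
    (X : Finset V)
    (hX : ((X ×ˢ Xᶜ).filter fun q => ω s(q.1, q.2) ≠ 0).card ≤ 2) {x y : V} (hx : x ∈ X)
    (hy : y ∉ X) : ω s(x, y) = 0 := by
  by_contra hne
  set N := (X ×ˢ Xᶜ).filter fun q => ω s(q.1, q.2) ≠ 0 with hN
  have hxy : x ≠ y := fun h => hy (h ▸ hx)
  have hmem : (x, y) ∈ N := by simp [hN, hx, hy, hne]
  have hcard : (N.erase (x, y)).card ≤ 1 := by
    rw [Finset.card_erase_of_mem hmem]; omega
  -- moments are taken about an end of the other edge, so that only `x y` contributes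
  obtain ⟨z, hzx, hzy, hz⟩ : ∃ z, z ≠ x ∧ z ≠ y ∧ ∀ q ∈ N, q ≠ (x, y) → q.1 = z ∨ q.2 = z := by
    rcases (N.erase (x, y)).eq_empty_or_nonempty with h0 | ⟨⟨a, b⟩, hab⟩
    · have : ({x, y} : Finset V).card < Fintype.card V :=
        (Finset.card_le_two).trans_lt hV
      obtain ⟨z, hz⟩ : ∃ z, z ∉ ({x, y} : Finset V) := by
        by_contra hcon
        push Not at hcon
        rw [Finset.eq_univ_iff_forall.mpr hcon, Finset.card_univ] at this
        exact lt_irrefl _ this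
      simp only [Finset.mem_insert, Finset.mem_singleton, not_or] at hz
      refine ⟨z, hz.1, hz.2, fun q hq hq' => ?_⟩
      have : q ∈ N.erase (x, y) := Finset.mem_erase.mpr ⟨hq', hq⟩
      simp [h0] at this
    · have huniq : ∀ q ∈ N, q ≠ (x, y) → q = (a, b) := fun q hq hq' =>
        Finset.card_le_one.mp hcard q (Finset.mem_erase.mpr ⟨hq', hq⟩) _ hab
      have habN := Finset.mem_of_mem_erase hab
      have habne := Finset.ne_of_mem_erase hab
      simp only [hN, Finset.mem_filter, Finset.mem_product, Finset.mem_compl] at habN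
      by_cases hax : a = x
      · refine ⟨b, fun h => habN.1.2 (h ▸ hx), fun h => habne (by rw [hax, h]), ?_⟩
        intro q hq hq'
        right; rw [huniq q hq hq']
      · refine ⟨a, hax, fun h => hy (h ▸ habN.1.1), ?_⟩
        intro q hq hq'
        left; rw [huniq q hq hq']
  have hsum := sum_cut_moment hω X (p z)
  rw [Finset.sum_eq_single (x, y)] at hsum
  · rcases mul_eq_zero.mp hsum with h | h
    · exact hne h
    · exact hp z x y hzx hzy hxy ((collinear_iff_area_eq_zero _ _ _).mpr h)
  · intro q hq hqne
    by_cases h0 : ω s(q.1, q.2) = 0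
    · rw [h0, zero_mul]
    · rcases hz q (Finset.mem_filter.mpr ⟨hq, h0⟩) hqne with h | h
      · rw [h, area_self_left, mul_zero]
      · rw [h, area_self_right, mul_zero]
  · intro h
    exact absurd (Finset.mem_product.mpr ⟨hx, Finset.mem_compl.mpr hy⟩) h

end Stress

/-! ### Counting edges inside vertex sets -/

section Counting

variable {V : Type*}

open Classical in
/-- The members of `E` with both ends in `X`. -/
noncomputable def inside (E : Finset (Sym2 V)) (X : Finset V) : Finset (Sym2 V) :=
  E.filter fun e => ∀ v ∈ e, v ∈ X

open Classical in
theorem mem_inside {E : Finset (Sym2 V)} {X : Finset V} {e : Sym2 V} :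
    e ∈ inside E X ↔ e ∈ E ∧ ∀ v ∈ e, v ∈ X := by
  unfold inside
  exact Finset.mem_filter

theorem mk_mem_inside {E : Finset (Sym2 V)} {X : Finset V} {a b : V} :
    s(a, b) ∈ inside E X ↔ s(a, b) ∈ E ∧ a ∈ X ∧ b ∈ X := by
  simp [mem_inside]

theorem inside_subset (E : Finset (Sym2 V)) (X : Finset V) : inside E X ⊆ E :=
  fun _ he => (mem_inside.mp he).1

open Classical in
/-- Every edge has two ends. -/
theorem sum_card_filter_mem {E : Finset (Sym2 V)} {X : Finset V} (hE : ∀ e ∈ E, ¬ e.IsDiag)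
    (hX : ∀ e ∈ E, ∀ v ∈ e, v ∈ X) :
    ∑ v ∈ X, (E.filter fun e => v ∈ e).card = 2 * E.card := by
  have h := Finset.sum_card_bipartiteAbove_eq_sum_card_bipartiteBelow
    (s := X) (t := E) (fun v e => v ∈ e)
  simp only [Finset.bipartiteAbove, Finset.bipartiteBelow] at h
  rw [h, mul_comm, Finset.sum_const_nat]
  intro e he
  have hd := hE e he
  have hv := hX e he
  induction e with
  | h a b =>
    have hab : a ≠ b := by simpa using hd
    have : X.filter (fun v => v ∈ s(a, b)) = {a, b} := by
      ext v
      simp only [Finset.mem_filter, Sym2.mem_iff, Finset.mem_insert, Finset.mem_singleton]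
      refine ⟨fun h => h.2, fun h => ⟨hv v (by simpa using h), h⟩⟩
    rw [this, Finset.card_pair hab]

open Classical in
/-- The number of neighbours of `x` in `Y`. -/
noncomputable def degIn (G : SimpleGraph V) (Y : Finset V) (x : V) : ℕ :=
  (Y.filter (G.Adj x)).card

/-- The number of pairs `(x, y) ∈ X × Y` of adjacent vertices; for disjoint `X` and `Y` this is the
number of edges between them. -/
noncomputable def cutCard (G : SimpleGraph V) (X Y : Finset V) : ℕ := ∑ x ∈ X, degIn G Y x

open Classical in
theorem degIn_add_degIn_sdiff (G : SimpleGraph V) {D C : Finset V} (h : D ⊆ C) (x : V) :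
    degIn G D x + degIn G (C \ D) x = degIn G C x := by
  simp only [degIn, Finset.card_filter]
  rw [add_comm, Finset.sum_sdiff h]

theorem degIn_mono (G : SimpleGraph V) {D C : Finset V} (h : D ⊆ C) (x : V) :
    degIn G D x ≤ degIn G C x := by
  classical
  exact Finset.card_le_card (Finset.filter_subset_filter _ h)

theorem degIn_lt_card (G : SimpleGraph V) {X : Finset V} {x : V} (hx : x ∈ X) :
    degIn G X x < X.card := by
  classical
  exact Finset.card_lt_card (Finset.filter_ssubset.mpr ⟨x, hx, G.irrefl⟩)

open Classical in
theorem cutCard_eq_card (G : SimpleGraph V) (X Y : Finset V) :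
    cutCard G X Y = ((X ×ˢ Y).filter fun q => G.Adj q.1 q.2).card := by
  simp only [cutCard, degIn, Finset.card_filter, Finset.sum_product]

open Classical in
theorem sum_degIn_add_cutCard (G : SimpleGraph V) {D C : Finset V} (h : D ⊆ C) :
    ∑ x ∈ D, degIn G D x + cutCard G D (C \ D) = ∑ x ∈ D, degIn G C x := by
  rw [cutCard, ← Finset.sum_add_distrib]
  exact Finset.sum_congr rfl fun x _ => degIn_add_degIn_sdiff G h x

variable [Fintype V]

open Classical in
theorem degIn_eq_card_filter_inside (G : SimpleGraph V) {X : Finset V} {x : V} (hx : x ∈ X) :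
    degIn G X x = ((inside G.edgeFinset X).filter fun e => x ∈ e).card := by
  have : (inside G.edgeFinset X).filter (fun e => x ∈ e) =
      (X.filter (G.Adj x)).image fun y => s(x, y) := by
    ext e
    simp only [Finset.mem_filter, Finset.mem_image]
    constructor
    · rintro ⟨he, hxe⟩
      obtain ⟨y, rfl⟩ := Sym2.mem_iff_exists.mp hxe
      rw [mk_mem_inside] at he
      exact ⟨y, ⟨he.2.2, by simpa using he.1⟩, rfl⟩
    · rintro ⟨y, ⟨hy, hadj⟩, rfl⟩
      exact ⟨mk_mem_inside.mpr ⟨by simpa using hadj, hx, hy⟩, by simp⟩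
  rw [this, Finset.card_image_of_injective _ fun a b h => Sym2.congr_right.mp h, degIn]

open Classical in
theorem sum_degIn_eq_two_mul (G : SimpleGraph V) (X : Finset V) :
    ∑ x ∈ X, degIn G X x = 2 * (inside G.edgeFinset X).card := by
  rw [← sum_card_filter_mem (X := X)]
  · exact Finset.sum_congr rfl fun x hx => degIn_eq_card_filter_inside G hx
  · intro e he
    exact G.not_isDiag_of_mem_edgeFinset (inside_subset _ _ he)
  · intro e he
    exact (mem_inside.mp he).2

theorem degIn_univ_of_isFourValent {G : SimpleGraph V} (hG : IsFourValent G) (x : V) :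
    degIn G Finset.univ x = 4 := by
  classical
  have h := hG x
  rw [degIn, ← h, ← SimpleGraph.card_neighborFinset_eq_degree]
  congr 1
  ext y
  simp

open Classical in
/-- In a 4-valent graph the number of edges inside `X` and the size of the cut around `X` determine
each other; in particular all cuts are even. -/
theorem two_mul_card_inside_add_cutCard {G : SimpleGraph V} (hG : IsFourValent G)
    (X : Finset V) :
    2 * (inside G.edgeFinset X).card + cutCard G X Xᶜ = 4 * X.card := by
  have h := sum_degIn_add_cutCard G (Finset.subset_univ X)
  rw [sum_degIn_eq_two_mul, ← Finset.compl_eq_univ_sdiff] at h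
  rw [h, Finset.sum_congr rfl fun x _ => degIn_univ_of_isFourValent hG x]
  simp [mul_comm]

open Classical in
theorem card_edgeFinset_of_isFourValent {G : SimpleGraph V} (hG : IsFourValent G) :
    G.edgeFinset.card = 2 * Fintype.card V := by
  have h := two_mul_card_inside_add_cutCard hG Finset.univ
  have h1 : inside G.edgeFinset Finset.univ = G.edgeFinset := by
    ext e
    simp [mem_inside]
  have h2 : cutCard G Finset.univ (Finset.univ : Finset V)ᶜ = 0 := by simp [cutCard, degIn]
  rw [h1, h2, Finset.card_univ] at h
  omega

theorem four_lt_card_of_isFourValent {G : SimpleGraph V} (hG : IsFourValent G) (x : V) :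
    4 < Fintype.card V := by
  have := degIn_lt_card G (Finset.mem_univ x)
  rwa [degIn_univ_of_isFourValent hG] at this

end Counting

/-! ### Stresses of frameworks in general position -/

section GeneralPosition

variable {V : Type*} [Fintype V]

theorem stressSpace_mono (p : Configuration V) {E E' : Finset (Sym2 V)} (h : E ⊆ E') :
    stressSpace p E ≤ stressSpace p E' :=
  fun _ hω => ⟨fun e he => hω.1 e fun h' => he (h h'), hω.2⟩

open Classical in
/-- A stress that vanishes on the cut around `X` restricts to a stress of the edges inside `X`. -/
theorem restrict_mem_stressSpace {p : Configuration V} {E : Finset (Sym2 V)} {ω : Sym2 V → ℝ}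
    (hω : ω ∈ stressSpace p E) {X : Finset V} (hX : ∀ x ∈ X, ∀ y ∉ X, ω s(x, y) = 0) :
    (fun e => if ∀ v ∈ e, v ∈ X then ω e else 0) ∈ stressSpace p (inside E X) := by
  refine ⟨fun e he => ?_, fun v i => ?_⟩
  · simp only [ite_eq_right_iff]
    intro h
    exact hω.1 e fun h' => he (mem_inside.mpr ⟨h', h⟩)
  · by_cases hv : v ∈ X
    · refine Eq.trans (Finset.sum_congr rfl fun u _ => ?_) (hω.2 v i)
      by_cases hu : u ∈ X
      · simp [hv, hu]
      · simp [hu, hX v hv u hu]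
    · simp [hv]

/-- The self-stresses supported inside `C`. -/
noncomputable abbrev stressIn (G : SimpleGraph V) (p : Configuration V) (C : Finset V) :
    Submodule ℝ (Sym2 V → ℝ) := by
  classical exact stressSpace p (inside G.edgeFinset C)

theorem stressIn_apply_eq_zero {G : SimpleGraph V} {p : Configuration V} {C : Finset V}
    {ω : Sym2 V → ℝ} (hω : ω ∈ stressIn G p C) {a b : V}
    (h : ¬ (G.Adj a b ∧ a ∈ C ∧ b ∈ C)) : ω s(a, b) = 0 := by
  classical
  refine hω.1 _ fun h' => h ?_
  simpa [mk_mem_inside] using h'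

open Classical in
/-- Across a cut of at most two edges the stress space splits. -/
theorem finrank_stressIn_le_of_cutCard_le_two {G : SimpleGraph V} {p : Configuration V}
    (hp : InGeneralPosition p) (hV : 2 < Fintype.card V) {X C : Finset V}
    (hcut : cutCard G X (C \ X) ≤ 2) :
    Module.finrank ℝ (stressIn G p C) ≤
      Module.finrank ℝ (stressIn G p X) + Module.finrank ℝ (stressIn G p (C \ X)) := by
  classical
  refine finrank_stressSpace_le_add p fun ω hω => ?_
  have h0 : ∀ x ∈ X, ∀ y ∉ X, ω s(x, y) = 0 := by
    intro x hx y hy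
    refine stress_eq_zero_of_card_cut_le_two hp hV hω X (le_trans ?_ hcut) hx hy
    rw [cutCard_eq_card]
    refine Finset.card_le_card fun q hq => ?_
    simp only [Finset.mem_filter, Finset.mem_product, Finset.mem_compl, Finset.mem_sdiff] at hq ⊢
    have : G.Adj q.1 q.2 ∧ q.1 ∈ C ∧ q.2 ∈ C := by
      by_contra h
      exact hq.2 (stressIn_apply_eq_zero hω h)
    exact ⟨⟨hq.1.1, this.2.2, hq.1.2⟩, this.1⟩
  have h1 := restrict_mem_stressSpace hω h0
  have h2 := restrict_mem_stressSpace hω (X := Xᶜ) fun x hx y hy => by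
    rw [Sym2.eq_swap]
    exact h0 y (by simpa using hy) x (by simpa using hx)
  refine Submodule.mem_sup.mpr ⟨_, stressSpace_mono p ?_ h1, _, stressSpace_mono p ?_ h2, ?_⟩
  · intro e he
    exact mem_inside.mpr ⟨inside_subset _ _ (inside_subset _ _ he),
      (mem_inside.mp he).2⟩
  · intro e he
    refine mem_inside.mpr ⟨inside_subset _ _ (inside_subset _ _ he), fun v hv => ?_⟩
    have h3 := (mem_inside.mp he).2 v hv
    have h4 := (mem_inside.mp (inside_subset _ _ he)).2 v hv
    simp only [Finset.mem_compl] at h3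
    simp [h3, h4]
  · funext e
    induction e with
    | h a b =>
      by_cases ha : a ∈ X <;> by_cases hb : b ∈ X
      · simp [ha, hb]
      · simp [ha, hb, h0 a ha b hb]
      · simp [ha, hb, Sym2.eq_swap (a := a) (b := b), h0 b hb a ha]
      · simp [ha, hb]

open Classical in
/-- Once a stress vanishes on all but two edges at a vertex, it vanishes on these two as well; so
deleting a vertex of degree `k + 2` costs at most `k` dimensions. -/
theorem finrank_stressIn_le_erase {G : SimpleGraph V} {p : Configuration V}
    (hp : InGeneralPosition p) (hV : 2 < Fintype.card V) {C : Finset V} {v : V}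
    {k : ℕ} (hk : degIn G C v = k + 2) :
    Module.finrank ℝ (stressIn G p C) ≤ Module.finrank ℝ (stressIn G p (C.erase v)) + k := by
  classical
  obtain ⟨T, hT, hTk⟩ := Finset.exists_subset_card_eq (n := k)
    (s := C.filter (G.Adj v)) (by unfold degIn at hk; omega)
  have hcard : (T.image fun y => s(v, y)).card = k := by
    rw [Finset.card_image_of_injective _ fun a b h => Sym2.congr_right.mp h, hTk]
  rw [← hcard]
  refine finrank_stressSpace_le_add_card p _ fun ω hω hT0 => ?_
  have h0 : ∀ y, y ≠ v → ω s(v, y) = 0 := by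
    intro y hy
    refine stress_eq_zero_of_card_cut_le_two hp hV hω {v} ?_ (Finset.mem_singleton_self v)
      (by simpa using hy)
    have h2 : ((C.filter (G.Adj v)) \ T).card = 2 := by
      rw [Finset.card_sdiff_of_subset hT, hTk]; unfold degIn at hk; omega
    rw [← h2]
    refine (Finset.card_le_card (t := ((C.filter (G.Adj v)) \ T).image fun y => (v, y)) ?_).trans
      Finset.card_image_le
    rintro ⟨a, b⟩ hq
    simp only [Finset.mem_filter, Finset.mem_product, Finset.mem_singleton] at hq
    obtain ⟨⟨rfl, -⟩, hq⟩ := hq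
    refine Finset.mem_image.mpr ⟨b, ?_, rfl⟩
    have : G.Adj a b ∧ a ∈ C ∧ b ∈ C := by
      by_contra h
      exact hq (stressIn_apply_eq_zero hω h)
    refine Finset.mem_sdiff.mpr ⟨by simp [this], fun hb => hq ?_⟩
    exact hT0 _ (Finset.mem_image_of_mem _ hb)
  refine ⟨fun e he => ?_, hω.2⟩
  induction e with
  | h a b =>
    by_contra hne
    have hab : G.Adj a b ∧ a ∈ C ∧ b ∈ C := by
      by_contra h
      exact hne (stressIn_apply_eq_zero hω h)
    apply he
    have hav : a ≠ v := by
      rintro rfl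
      exact hne (h0 b hab.1.ne')
    have hbv : b ≠ v := by
      rintro rfl
      rw [Sym2.eq_swap] at hne
      exact hne (h0 a hab.1.ne)
    exact mk_mem_inside.mpr ⟨by simpa using hab.1, by simp [hab, hav], by simp [hab, hbv]⟩

open Classical in
/-- `C` has at least two vertices and every cut of the subgraph induced on `C` has at least three
edges. -/
def IsThreeEdgeConnectedOn (G : SimpleGraph V) (C : Finset V) : Prop :=
  2 ≤ C.card ∧ ∀ X ⊆ C, X.Nonempty → X ≠ C → 3 ≤ cutCard G X (C \ X)

/-- Splitting along cuts of at most two edges reduces an additive bound on the dimension of the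
stress space to vertex sets that induce 3-edge-connected subgraphs. -/
theorem mul_finrank_stressIn_le_sum {G : SimpleGraph V} {p : Configuration V}
    (hp : InGeneralPosition p) (hV : 2 < Fintype.card V) (k : ℕ) (w : V → ℕ) (C : Finset V)
    (h : ∀ D ⊆ C, IsThreeEdgeConnectedOn G D →
      k * Module.finrank ℝ (stressIn G p D) ≤ ∑ u ∈ D, w u) :
    k * Module.finrank ℝ (stressIn G p C) ≤ ∑ u ∈ C, w u := by
  classical
  induction C using Finset.strongInduction with
  | H C ih =>
    by_cases hC : IsThreeEdgeConnectedOn G C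
    · exact h C subset_rfl hC
    · by_cases h2 : 2 ≤ C.card
      · obtain ⟨X, hXC, hXn, hXne, hX⟩ : ∃ X ⊆ C, X.Nonempty ∧ X ≠ C ∧
            cutCard G X (C \ X) < 3 := by
          by_contra hcon
          push Not at hcon
          exact hC ⟨h2, hcon⟩
        have hss : X ⊂ C := hXC.ssubset_of_ne hXne
        have hss' : C \ X ⊂ C := Finset.sdiff_ssubset hXC hXn
        have h3 := ih X hss fun D hD => h D (hD.trans hXC)
        have h4 := ih (C \ X) hss' fun D hD => h D (hD.trans Finset.sdiff_subset)
        have h5 := finrank_stressIn_le_of_cutCard_le_two hp hV (Nat.lt_succ_iff.mp hX)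
        have h6 := Finset.sum_sdiff (f := w) hXC
        calc _ ≤ k * (_ + _) := Nat.mul_le_mul_left k h5
          _ ≤ _ := by rw [mul_add]; omega
      · have h0 : stressIn G p C = ⊥ := by
          rw [eq_bot_iff]
          intro ω hω
          rw [Submodule.mem_bot]
          funext e
          induction e with
          | h a b =>
            refine stressIn_apply_eq_zero hω fun hab => hab.1.ne ?_
            exact Finset.card_le_one.mp (by omega) a hab.2.1 b hab.2.2
        rw [h0, finrank_bot, mul_zero]
        exact Nat.zero_le _

omit [Fintype V] in
theorem IsThreeEdgeConnectedOn.three_le_degIn {G : SimpleGraph V} {C : Finset V}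
    (hC : IsThreeEdgeConnectedOn G C) {v : V} (hv : v ∈ C) : 3 ≤ degIn G C v := by
  classical
  have h := hC.2 {v} (by simpa using hv) (by simp) (by
    rintro rfl
    have := hC.1
    simp at this)
  simp only [cutCard, Finset.sum_singleton] at h
  exact h.trans (degIn_mono G Finset.sdiff_subset v)

omit [Fintype V] in
open Classical in
/-- Passing from `C` to a subset `D` inducing a 3-edge-connected graph, every edge of the cut between
`D` and `C \ D` turns a vertex of degree 4 into one of degree 3, and no two of them the same. -/
theorem IsThreeEdgeConnectedOn.card_degIn_four_add_cutCard_le {G : SimpleGraph V}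
    {C D : Finset V} (hD : IsThreeEdgeConnectedOn G D) (hDC : D ⊆ C)
    (hdeg : ∀ u ∈ D, degIn G C u ≤ 4) :
    (D.filter fun u => degIn G D u = 4).card + cutCard G D (C \ D) ≤
      ∑ u ∈ D, if degIn G C u = 4 then 1 else 0 := by
  rw [cutCard, Finset.card_filter, ← Finset.sum_add_distrib]
  refine Finset.sum_le_sum fun u hu => ?_
  have h1 := degIn_add_degIn_sdiff G hDC u
  have h2 := hdeg u hu
  have h3 := hD.three_le_degIn hu
  split_ifs <;> omega

omit [Fintype V] in
open Classical in
/-- A proper subset with nonempty cut contains a vertex that lost an edge. -/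
theorem exists_degIn_le_three {G : SimpleGraph V} {C D : Finset V} (hDC : D ⊆ C)
    (hdeg : ∀ u ∈ D, degIn G C u ≤ 4) (hcut : 0 < cutCard G D (C \ D)) :
    ∃ u ∈ D, degIn G D u ≤ 3 := by
  by_contra hcon
  push Not at hcon
  have : cutCard G D (C \ D) = 0 := Finset.sum_eq_zero fun u hu => by
    have h1 := degIn_add_degIn_sdiff G hDC u
    have h2 := hdeg u hu
    have h3 := hcon u hu
    omega
  omega

/-- Deleting a vertex of degree 3 costs one dimension. Each 3-edge-connected piece of what remains
is separated by at least three edges, whose ends had degree 4; so the pieces together have enough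
fewer vertices of degree 4 to pay for it. -/
theorem IsThreeEdgeConnectedOn.three_mul_finrank_stressIn_le {G : SimpleGraph V}
    {p : Configuration V} (hp : InGeneralPosition p) (hV : 2 < Fintype.card V) {C : Finset V}
    (hC : IsThreeEdgeConnectedOn G C) (hdeg : ∀ u ∈ C, degIn G C u ≤ 4)
    (hv : ∃ v ∈ C, degIn G C v ≤ 3) :
    3 * Module.finrank ℝ (stressIn G p C) ≤ (C.filter fun u => degIn G C u = 4).card + 3 := by
  classical
  induction C using Finset.strongInduction with
  | H C ih =>
    obtain ⟨v, hvC, hv3⟩ := hv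
    have hv3' := hC.three_le_degIn hvC
    have h1 := finrank_stressIn_le_erase hp hV (G := G) (C := C) (v := v) (k := 1) (by omega)
    have h2 := mul_finrank_stressIn_le_sum (G := G) hp hV 3
      (fun u => if degIn G C u = 4 then 1 else 0) (C.erase v) (by
      intro D hD hDgood
      have hDC : D ⊆ C := hD.trans (Finset.erase_subset v C)
      have hvD : v ∉ D := fun h => by simpa using hD h
      have hne : D ≠ C := fun h => hvD (h ▸ hvC)
      have hn : D.Nonempty := Finset.card_pos.mp (by have := hDgood.1; omega)
      have hcut := hC.2 D hDC hn hne
      have hdeg' : ∀ u ∈ D, degIn G C u ≤ 4 := fun u hu => hdeg u (hDC hu)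
      have h3 := ih D (hDC.ssubset_of_ne hne) hDgood
        (fun u hu => (degIn_mono G hDC u).trans (hdeg' u hu))
        (exists_degIn_le_three hDC hdeg' (by omega))
      have h4 := hDgood.card_degIn_four_add_cutCard_le hDC hdeg'
      omega)
    have h5 : ∑ u ∈ C.erase v, (if degIn G C u = 4 then 1 else 0) ≤
        (C.filter fun u => degIn G C u = 4).card := by
      rw [Finset.card_filter]
      exact Finset.sum_le_sum_of_subset (Finset.erase_subset v C)
    omega

open Classical in
theorem card_edgeFinset_eq_rigidityRank_add {G : SimpleGraph V} (p : Configuration V) :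
    G.edgeFinset.card = rigidityRank G p + Module.finrank ℝ (stressIn G p Finset.univ) := by
  have h1 : inside G.edgeFinset Finset.univ = G.edgeFinset := by
    ext e
    simp [mem_inside]
  rw [stressIn, h1, rigidityRank_add_finrank_stressSpace]

open Classical in
/-- Deleting a vertex of a 4-valent 3-edge-connected graph costs two dimensions. The cuts around the
remaining 3-edge-connected pieces have at least four edges by parity. -/
theorem three_mul_finrank_stressIn_univ_le {G : SimpleGraph V} {p : Configuration V}
    (hp : InGeneralPosition p) (hG : IsFourValent G)
    (hC : IsThreeEdgeConnectedOn G Finset.univ) :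
    3 * Module.finrank ℝ (stressIn G p Finset.univ) ≤ Fintype.card V + 4 := by
  have h2 := hC.1
  rw [Finset.card_univ] at h2
  obtain ⟨v, u₀, huv⟩ := Fintype.exists_pair_of_one_lt_card (α := V) (by omega)
  have hV := four_lt_card_of_isFourValent hG v
  have hdeg := degIn_univ_of_isFourValent hG
  have h1 := finrank_stressIn_le_erase hp (by omega) (G := G) (C := Finset.univ) (v := v) (k := 2)
    (hdeg v)
  -- the weight is 1 except at one vertex: a piece `D` needs no more than `|D| - 1`
  have h3 := mul_finrank_stressIn_le_sum (G := G) hp (by omega) 3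
    (fun u => if u = u₀ then 0 else 1) (Finset.univ.erase v) (by
    intro D hD hDgood
    have hvD : v ∉ D := fun h => by simpa using hD h
    have hne : D ≠ Finset.univ := fun h => hvD (h ▸ Finset.mem_univ v)
    have hn : D.Nonempty := Finset.card_pos.mp (by have := hDgood.1; omega)
    have hcut := hC.2 D (Finset.subset_univ D) hn hne
    have h5 := hDgood.three_mul_finrank_stressIn_le hp (by omega)
      (fun u _ => (degIn_mono G (Finset.subset_univ D) u).trans (hdeg u).le)
      (exists_degIn_le_three (Finset.subset_univ D) (fun u _ => (hdeg u).le) (by omega))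
    have h4 := hDgood.card_degIn_four_add_cutCard_le (Finset.subset_univ D)
      (fun u _ => (hdeg u).le)
    have h6 := two_mul_card_inside_add_cutCard hG D
    rw [Finset.compl_eq_univ_sdiff] at h6
    have h7 : ∑ u ∈ D, (if degIn G Finset.univ u = 4 then 1 else 0) = D.card := by
      simp [hdeg]
    have h8 : D.card ≤ ∑ u ∈ D, (if u = u₀ then 0 else 1) + 1 := by
      have : D.card = ∑ u ∈ D, ((if u = u₀ then 0 else 1) + if u = u₀ then 1 else 0) := by
        rw [Finset.card_eq_sum_ones]
        exact Finset.sum_congr rfl fun u _ => by split_ifs <;> rfl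
      rw [this, Finset.sum_add_distrib, Finset.sum_ite_eq' D u₀]
      split_ifs <;> omega
    omega)
  have h9 : ∑ u ∈ Finset.univ.erase v, (if u = u₀ then 0 else 1) + 2 = Fintype.card V := by
    have h10 : ∑ u ∈ Finset.univ.erase v, (if u = u₀ then 0 else 1) =
        ((Finset.univ.erase v).erase u₀).card := by
      rw [Finset.card_eq_sum_ones, Finset.sum_ite, Finset.sum_const_zero, zero_add]
      congr 1
      ext u
      simp [and_comm]
    rw [h10, Finset.card_erase_of_mem (by simp [huv.symm]),
      Finset.card_erase_of_mem (Finset.mem_univ v), Finset.card_univ]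
    omega
  omega

open Classical in
/-- If a connected 4-valent graph is not 3-edge-connected, then the cut around a piece `D` in its
decomposition has at least two edges by parity, so that `3 * dim ≤ |D| + 1`; as `|D| ≥ 4`, this gives
`5 * dim ≤ 2 * |D|`. -/
theorem five_mul_finrank_stressIn_univ_le {G : SimpleGraph V} {p : Configuration V}
    (hp : InGeneralPosition p) (hG : IsFourValent G)
    (hconn : ∀ X : Finset V, X.Nonempty → X ≠ Finset.univ → 0 < cutCard G X Xᶜ) :
    5 * Module.finrank ℝ (stressIn G p Finset.univ) ≤ 2 * Fintype.card V + 5 := by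
  have hdeg := degIn_univ_of_isFourValent hG
  rcases isEmpty_or_nonempty V with hE | ⟨⟨v⟩⟩
  · have h : stressIn G p Finset.univ = ⊥ := by
      rw [eq_bot_iff]
      intro ω _
      rw [Submodule.mem_bot]
      funext e
      induction e with
      | h a b => exact hE.elim a
    rw [h, finrank_bot]
    omega
  have hV := four_lt_card_of_isFourValent hG v
  by_cases hC : IsThreeEdgeConnectedOn G Finset.univ
  · have := three_mul_finrank_stressIn_univ_le hp hG hC
    omega
  · have h3 := mul_finrank_stressIn_le_sum (G := G) hp (by omega) 5 (fun _ => 2) Finset.univ (by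
      intro D _ hDgood
      have hne : D ≠ Finset.univ := fun h => hC (h ▸ hDgood)
      have hn : D.Nonempty := Finset.card_pos.mp (by have := hDgood.1; omega)
      have hcut := hconn D hn hne
      rw [Finset.compl_eq_univ_sdiff] at hcut
      have h5 := hDgood.three_mul_finrank_stressIn_le hp (by omega)
        (fun u _ => (degIn_mono G (Finset.subset_univ D) u).trans (hdeg u).le)
        (exists_degIn_le_three (Finset.subset_univ D) (fun u _ => (hdeg u).le) hcut)
      have h4 := hDgood.card_degIn_four_add_cutCard_le (Finset.subset_univ D)
        (fun u _ => (hdeg u).le)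
      have h6 := two_mul_card_inside_add_cutCard hG D
      rw [Finset.compl_eq_univ_sdiff] at h6
      have h7 : ∑ u ∈ D, (if degIn G Finset.univ u = 4 then 1 else 0) = D.card := by
        simp [hdeg]
      obtain ⟨x, hx⟩ := hn
      have h8 := hDgood.three_le_degIn hx
      have h9 := degIn_lt_card G hx
      rw [Finset.sum_const, smul_eq_mul]
      omega)
    rw [Finset.sum_const, smul_eq_mul, Finset.card_univ] at h3
    omega

/-! ### Vertex connectivity and cuts -/

omit [Fintype V] in
/-- A reachable pair of vertices on different sides of `X` yields an edge across `X`. -/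
theorem exists_adj_of_preconnected {G : SimpleGraph V} {U X : Finset V}
    (h : (G.induce {v | v ∉ U}).Preconnected) {a b : V} (haU : a ∉ U) (hbU : b ∉ U) (ha : a ∈ X)
    (hb : b ∉ X) : ∃ x ∈ X, ∃ y ∉ X, x ∉ U ∧ y ∉ U ∧ G.Adj x y := by
  obtain ⟨w⟩ := h ⟨a, haU⟩ ⟨b, hbU⟩
  obtain ⟨d, -, hd1, hd2⟩ := w.exists_boundary_dart {v | v.1 ∈ X} ha hb
  exact ⟨d.fst.1, hd1, d.snd.1, hd2, d.fst.2, d.snd.2, d.adj⟩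

omit [Fintype V] in
theorem cutCard_pos_of_adj {G : SimpleGraph V} {X Y : Finset V} {x y : V} (hx : x ∈ X)
    (hy : y ∈ Y) (h : G.Adj x y) : 0 < cutCard G X Y := by
  classical
  rw [cutCard_eq_card]
  exact Finset.card_pos.mpr ⟨(x, y), by simp [hx, hy, h]⟩

open Classical in
theorem IsVertexConnected.cutCard_pos {G : SimpleGraph V} {k : ℕ} (hk : 0 < k)
    (h : IsVertexConnected G k) {X : Finset V} (hn : X.Nonempty) (hne : X ≠ Finset.univ) :
    0 < cutCard G X Xᶜ := by
  obtain ⟨a, ha⟩ := hn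
  obtain ⟨b, hb⟩ : ∃ b, b ∉ X := by
    by_contra hcon
    push Not at hcon
    exact hne (Finset.eq_univ_iff_forall.mpr hcon)
  obtain ⟨x, hx, y, hy, -, -, hxy⟩ :=
    exists_adj_of_preconnected (h ∅ (by simpa using hk)) (by simp) (by simp) ha hb
  exact cutCard_pos_of_adj hx (Finset.mem_compl.mpr hy) hxy

open Classical in
/-- A 3-vertex-connected 4-valent graph has no cut of two edges: removing the ends of the edges on
one side would disconnect it. -/
theorem IsVertexConnected.isThreeEdgeConnectedOn_univ {G : SimpleGraph V} [Nonempty V]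
    (hG : IsFourValent G) (h : IsVertexConnected G 3) :
    IsThreeEdgeConnectedOn G Finset.univ := by
  have hdeg := degIn_univ_of_isFourValent hG
  obtain ⟨v⟩ := ‹Nonempty V›
  have hV := four_lt_card_of_isFourValent hG v
  refine ⟨by rw [Finset.card_univ]; omega, fun X _ hn hne => ?_⟩
  rw [← Finset.compl_eq_univ_sdiff]
  by_contra hcut
  push Not at hcut
  set U := X.filter fun x => degIn G Xᶜ x ≠ 0 with hU
  have hUcut : U.card ≤ cutCard G X Xᶜ := by
    rw [cutCard, hU, Finset.card_filter]
    exact Finset.sum_le_sum fun x _ => by split_ifs <;> omega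
  obtain ⟨a, haX, haU⟩ : ∃ a ∈ X, a ∉ U := by
    by_contra hcon
    push Not at hcon
    have hXU : X.card ≤ U.card := Finset.card_le_card hcon
    obtain ⟨x, hx⟩ := hn
    have h1 := degIn_lt_card G hx
    have h2 := degIn_add_degIn_sdiff G (Finset.subset_univ X) x
    rw [hdeg, ← Finset.compl_eq_univ_sdiff] at h2
    have h3 : degIn G Xᶜ x ≤ cutCard G X Xᶜ :=
      Finset.single_le_sum (f := degIn G Xᶜ) (fun _ _ => Nat.zero_le _) hx
    omega
  obtain ⟨b, hb⟩ : ∃ b, b ∉ X := by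
    by_contra hcon
    push Not at hcon
    exact hne (Finset.eq_univ_iff_forall.mpr hcon)
  obtain ⟨x, hx, y, hy, hxU, -, hxy⟩ := exists_adj_of_preconnected (h U (by omega)) haU
    (fun h => hb (Finset.mem_filter.mp h).1) haX hb
  refine hxU (Finset.mem_filter.mpr ⟨hx, ?_⟩)
  have := cutCard_pos_of_adj (Finset.mem_singleton_self x) (Finset.mem_compl.mpr hy) hxy
  rw [cutCard, Finset.sum_singleton] at this
  omega

end GeneralPosition

/-! ### Sparse edge sets -/

section Sparse

variable {V : Type*}

theorem inside_empty_of_card_le_one {E : Finset (Sym2 V)} (hE : ∀ e ∈ E, ¬ e.IsDiag)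
    {X : Finset V} (hX : X.card ≤ 1) : inside E X = ∅ := by
  rw [Finset.eq_empty_iff_forall_notMem]
  intro e he
  rw [mem_inside] at he
  have hd := hE e he.1
  induction e with
  | h a b =>
    have h1 := he.2 a (by simp)
    have h2 := he.2 b (by simp)
    exact hd (Finset.card_le_one.mp hX a h1 b h2)

open Classical in
theorem inside_inter (E : Finset (Sym2 V)) (X Y : Finset V) :
    inside E X ∩ inside E Y = inside E (X ∩ Y) := by
  ext e
  simp only [Finset.mem_inter, mem_inside]
  exact ⟨fun h => ⟨h.1.1, fun v hv => ⟨h.1.2 v hv, h.2.2 v hv⟩⟩,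
    fun h => ⟨⟨h.1, fun v hv => (h.2 v hv).1⟩, ⟨h.1, fun v hv => (h.2 v hv).2⟩⟩⟩

theorem inside_mono (E : Finset (Sym2 V)) {X Y : Finset V} (h : X ⊆ Y) :
    inside E X ⊆ inside E Y := by
  intro e he
  rw [mem_inside] at he ⊢
  exact ⟨he.1, fun v hv => h (he.2 v hv)⟩

theorem inside_mono_left {E E' : Finset (Sym2 V)} (h : E ⊆ E') (X : Finset V) :
    inside E X ⊆ inside E' X := by
  intro e he
  rw [mem_inside] at he ⊢
  exact ⟨h he.1, he.2⟩

open Classical in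
/-- The number of edges inside a vertex set is supermodular. -/
theorem card_inside_add_card_inside_le (E : Finset (Sym2 V)) (X Y : Finset V) :
    (inside E X).card + (inside E Y).card ≤
      (inside E (X ∪ Y)).card + (inside E (X ∩ Y)).card := by
  rw [← Finset.card_union_add_card_inter, inside_inter]
  gcongr
  exact Finset.union_subset (inside_mono E Finset.subset_union_left)
    (inside_mono E Finset.subset_union_right)

/-- Laman's count: a set of edges is sparse if it has no loops and any set of `k ≥ 2` vertices spans
at most `2 k - 3` of its members. -/
def IsSparse (E : Finset (Sym2 V)) : Prop :=
  (∀ e ∈ E, ¬ e.IsDiag) ∧ ∀ X : Finset V, 2 ≤ X.card → (inside E X).card + 3 ≤ 2 * X.card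

theorem IsSparse.mono {E E' : Finset (Sym2 V)} (hE : IsSparse E) (h : E' ⊆ E) : IsSparse E' :=
  ⟨fun e he => hE.1 e (h he), fun X hX =>
    (Nat.add_le_add_right (Finset.card_le_card (inside_mono_left h X)) 3).trans (hE.2 X hX)⟩

open Classical in
/-- If no tight set of `E` contains both ends of `a b`, this edge can be added. -/
theorem IsSparse.insert_of_forall_not_tight {E : Finset (Sym2 V)} (hE : IsSparse E) {a b : V}
    (hab : a ≠ b)
    (h : ∀ X : Finset V, a ∈ X → b ∈ X → (inside E X).card + 3 < 2 * X.card) :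
    s(a, b) ∉ E ∧ IsSparse (insert s(a, b) E) := by
  constructor
  · intro hmem
    have h1 := h {a, b} (by simp) (by simp)
    have h2 : 0 < (inside E {a, b}).card :=
      Finset.card_pos.mpr ⟨s(a, b), mk_mem_inside.mpr ⟨hmem, by simp, by simp⟩⟩
    rw [Finset.card_pair hab] at h1
    omega
  · refine ⟨?_, fun X hX => ?_⟩
    · intro e he
      rcases Finset.mem_insert.mp he with rfl | he
      · simpa using hab
      · exact hE.1 e he
    · by_cases hX' : a ∈ X ∧ b ∈ X
      · have h1 := h X hX'.1 hX'.2
        have h2 : inside (insert s(a, b) E) X ⊆ insert s(a, b) (inside E X) := by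
          intro e he
          rw [mem_inside, Finset.mem_insert] at he
          rw [Finset.mem_insert, mem_inside]
          exact he.1.imp_right fun h => ⟨h, he.2⟩
        have h3 := (Finset.card_le_card h2).trans (Finset.card_insert_le _ _)
        omega
      · have h2 : inside (insert s(a, b) E) X ⊆ inside E X := by
          intro e he
          rw [mem_inside, Finset.mem_insert] at he
          rcases he.1 with rfl | he1
          · exact absurd ⟨he.2 a (by simp), he.2 b (by simp)⟩ hX'
          · exact mem_inside.mpr ⟨he1, he.2⟩
        exact (Nat.add_le_add_right (Finset.card_le_card h2) 3).trans (hE.2 X hX)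

open Classical in
/-- The uncrossing step of Laman's theorem: if `v` has the three neighbours `a`, `b`, `c`, the pairs
among these cannot all lie in tight sets of the edges not at `v`. -/
theorem IsSparse.not_all_tight {E : Finset (Sym2 V)} (hE : IsSparse E) {v a b c : V}
    (hav : a ≠ v) (hbv : b ≠ v) (hcv : c ≠ v) (hab : a ≠ b) (hac : a ≠ c) (hbc : b ≠ c)
    (ha : s(v, a) ∈ E) (hb : s(v, b) ∈ E) (hc : s(v, c) ∈ E) {A B C : Finset V}
    (hA : b ∈ A ∧ c ∈ A) (hB : a ∈ B ∧ c ∈ B) (hC : a ∈ C ∧ b ∈ C)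
    (htA : 2 * A.card ≤ (inside (E.filter (v ∉ ·)) A).card + 3)
    (htB : 2 * B.card ≤ (inside (E.filter (v ∉ ·)) B).card + 3)
    (htC : 2 * C.card ≤ (inside (E.filter (v ∉ ·)) C).card + 3) : False := by
  set F := E.filter (v ∉ ·) with hF
  have hFs : IsSparse F := hE.mono (Finset.filter_subset _ _)
  -- a set containing all three neighbours has room for the three edges at `v`
  have key (Z : Finset V) (h1 : a ∈ Z) (h2 : b ∈ Z) (h3 : c ∈ Z) :
      (inside F Z).card + 4 ≤ 2 * Z.card := by
    have hZ' : (inside F Z).card = (inside F (Z.erase v)).card := by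
      congr 1
      ext e
      simp only [mem_inside, hF, Finset.mem_filter, Finset.mem_erase]
      refine ⟨fun h => ⟨h.1, fun u hu => ⟨?_, h.2 u hu⟩⟩, fun h => ⟨h.1, fun u hu => (h.2 u hu).2⟩⟩
      rintro rfl
      exact h.1.2 hu
    have h4 : inside F (Z.erase v) ∪ {s(v, a), s(v, b), s(v, c)} ⊆
        inside E (insert v (Z.erase v)) := by
      intro e he
      rcases Finset.mem_union.mp he with he | he
      · rw [mem_inside] at he ⊢
        exact ⟨(Finset.mem_filter.mp he.1).1, fun u hu => Finset.mem_insert_of_mem (he.2 u hu)⟩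
      · simp only [Finset.mem_insert, Finset.mem_singleton] at he
        rcases he with rfl | rfl | rfl
        · exact mk_mem_inside.mpr ⟨ha, by simp, by simp [h1, hav]⟩
        · exact mk_mem_inside.mpr ⟨hb, by simp, by simp [h2, hbv]⟩
        · exact mk_mem_inside.mpr ⟨hc, by simp, by simp [h3, hcv]⟩
    have h5 : Disjoint (inside F (Z.erase v)) {s(v, a), s(v, b), s(v, c)} := by
      rw [Finset.disjoint_left]
      intro e he he'
      have h6 := (Finset.mem_filter.mp (inside_subset _ _ he)).2
      simp only [Finset.mem_insert, Finset.mem_singleton] at he'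
      rcases he' with rfl | rfl | rfl <;> simp at h6
    have h6 : ({s(v, a), s(v, b), s(v, c)} : Finset (Sym2 V)).card = 3 := by
      rw [Finset.card_eq_three]
      refine ⟨_, _, _, ?_, ?_, ?_, rfl⟩
      · exact fun h => hab (Sym2.congr_right.mp h)
      · exact fun h => hac (Sym2.congr_right.mp h)
      · exact fun h => hbc (Sym2.congr_right.mp h)
    have h7 := Finset.card_le_card h4
    rw [Finset.card_union_of_disjoint h5, h6] at h7
    have h8 : (Z.erase v).card ≤ Z.card := Finset.card_le_card (Finset.erase_subset _ _)
    have h9 : 1 ≤ (Z.erase v).card := Finset.card_pos.mpr ⟨a, by simp [h1, hav]⟩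
    have h10 := hE.2 (insert v (Z.erase v)) (by rw [Finset.card_insert_of_notMem (by simp)]; omega)
    rw [Finset.card_insert_of_notMem (by simp)] at h10
    omega
  -- the union of two tight sets with two common vertices is tight
  have uncross (X Y : Finset V) (hX : 2 * X.card ≤ (inside F X).card + 3)
      (hY : 2 * Y.card ≤ (inside F Y).card + 3) (h1 : a ∈ X ∪ Y) (h2 : b ∈ X ∪ Y)
      (h3 : c ∈ X ∪ Y) : (X ∩ Y).card ≤ 1 := by
    by_contra hcon
    have h4 := hFs.2 (X ∩ Y) (by omega)
    have h5 := key (X ∪ Y) h1 h2 h3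
    have h6 := card_inside_add_card_inside_le F X Y
    have h7 := Finset.card_union_add_card_inter X Y
    omega
  have hAB := uncross A B htA htB (by simp [hB]) (by simp [hA]) (by simp [hA])
  have hAC := uncross A C htA htC (by simp [hC]) (by simp [hA]) (by simp [hA])
  have hBC := uncross B C htB htC (by simp [hB]) (by simp [hC]) (by simp [hB])
  -- the three sets span disjoint sets of edges, and their union is tight
  have hZ := key (A ∪ B ∪ C) (by simp [hB]) (by simp [hA]) (by simp [hA])
  have hdis : (inside F A).card + (inside F B).card + (inside F C).card ≤
      (inside F (A ∪ B ∪ C)).card := by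
    have hd {X Y : Finset V} (h : (X ∩ Y).card ≤ 1) : Disjoint (inside F X) (inside F Y) := by
      rw [Finset.disjoint_iff_inter_eq_empty, inside_inter,
        inside_empty_of_card_le_one hFs.1 h]
    rw [← Finset.card_union_of_disjoint (hd hAB), ← Finset.card_union_of_disjoint
      (Finset.disjoint_union_left.mpr ⟨hd hAC, hd hBC⟩)]
    refine Finset.card_le_card (Finset.union_subset (Finset.union_subset ?_ ?_) ?_)
    · exact inside_mono F (Finset.subset_union_left.trans Finset.subset_union_left)
    · exact inside_mono F (Finset.subset_union_right.trans Finset.subset_union_left)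
    · exact inside_mono F Finset.subset_union_right
  have h1 := Finset.card_union_add_card_inter A B
  have h2 := Finset.card_union_add_card_inter (A ∪ B) C
  have h3 : 1 ≤ (A ∩ B).card := Finset.card_pos.mpr ⟨c, by simp [hA, hB]⟩
  have h4 : 2 ≤ ((A ∪ B) ∩ C).card := by
    rw [← Finset.card_pair hab]
    refine Finset.card_le_card fun x hx => ?_
    simp only [Finset.mem_insert, Finset.mem_singleton] at hx
    rcases hx with rfl | rfl
    · simp [hB, hC]
    · simp [hA, hC]
  omega

open Classical in
/-- The combinatorial half of Laman's theorem for a vertex of degree 3: it can be deleted, and one of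
the pairs of its neighbours joined by a new edge, without losing sparsity. -/
theorem IsSparse.exists_reduction {E : Finset (Sym2 V)} (hE : IsSparse E) {v : V}
    (hv : (E.filter (v ∈ ·)).card = 3) :
    ∃ a b c : V, a ≠ v ∧ b ≠ v ∧ c ≠ v ∧ a ≠ b ∧ a ≠ c ∧ b ≠ c ∧
      E.filter (v ∈ ·) = {s(v, a), s(v, b), s(v, c)} ∧
      s(a, b) ∉ E.filter (v ∉ ·) ∧ IsSparse (insert s(a, b) (E.filter (v ∉ ·))) := by
  obtain ⟨x, y, z, hxy, hxz, hyz, hxyz⟩ := Finset.card_eq_three.mp hv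
  have hx : x ∈ E.filter (v ∈ ·) := by simp [hxyz]
  have hy : y ∈ E.filter (v ∈ ·) := by simp [hxyz]
  have hz : z ∈ E.filter (v ∈ ·) := by simp [hxyz]
  rw [Finset.mem_filter] at hx hy hz
  obtain ⟨a, rfl⟩ := Sym2.mem_iff_exists.mp hx.2
  obtain ⟨b, rfl⟩ := Sym2.mem_iff_exists.mp hy.2
  obtain ⟨c, rfl⟩ := Sym2.mem_iff_exists.mp hz.2
  have hne {u : V} (h : s(v, u) ∈ E) : u ≠ v := fun h' => hE.1 _ h (by simp [h'])
  have hav := hne hx.1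
  have hbv := hne hy.1
  have hcv := hne hz.1
  have hab : a ≠ b := fun h => hxy (by rw [h])
  have hac : a ≠ c := fun h => hxz (by rw [h])
  have hbc : b ≠ c := fun h => hyz (by rw [h])
  have hFs : IsSparse (E.filter (v ∉ ·)) := hE.mono (Finset.filter_subset _ _)
  by_cases h1 : ∀ X : Finset V, a ∈ X → b ∈ X →
      (inside (E.filter (v ∉ ·)) X).card + 3 < 2 * X.card
  · exact ⟨a, b, c, hav, hbv, hcv, hab, hac, hbc, hxyz, hFs.insert_of_forall_not_tight hab h1⟩
  by_cases h2 : ∀ X : Finset V, a ∈ X → c ∈ X →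
      (inside (E.filter (v ∉ ·)) X).card + 3 < 2 * X.card
  · exact ⟨a, c, b, hav, hcv, hbv, hac, hab, hbc.symm, by rw [hxyz, Finset.pair_comm],
      hFs.insert_of_forall_not_tight hac h2⟩
  by_cases h3 : ∀ X : Finset V, b ∈ X → c ∈ X →
      (inside (E.filter (v ∉ ·)) X).card + 3 < 2 * X.card
  · refine ⟨b, c, a, hbv, hcv, hav, hbc, hab.symm, hac.symm, ?_,
      hFs.insert_of_forall_not_tight hbc h3⟩
    rw [hxyz]
    ext e
    simp only [Finset.mem_insert, Finset.mem_singleton]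
    tauto
  push Not at h1 h2 h3
  obtain ⟨C, hC1, hC2, hC⟩ := h1
  obtain ⟨B, hB1, hB2, hB⟩ := h2
  obtain ⟨A, hA1, hA2, hA⟩ := h3
  exact (hE.not_all_tight hav hbv hcv hab hac hbc hx.1 hy.1 hz.1 ⟨hA1, hA2⟩ ⟨hB1, hB2⟩
    ⟨hC1, hC2⟩ hA hB hC).elim

variable [Fintype V]

open Classical in
theorem IsSparse.exists_degree_le_three {E : Finset (Sym2 V)} (hE : IsSparse E)
    (hn : E.Nonempty) :
    ∃ v, (E.filter (v ∈ ·)).Nonempty ∧ (E.filter (v ∈ ·)).card ≤ 3 := by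
  by_contra hcon
  push Not at hcon
  let X : Finset V := Finset.univ.filter fun v => (E.filter (v ∈ ·)).Nonempty
  have hmem : ∀ e ∈ E, ∀ v ∈ e, v ∈ X := fun e he v hv =>
    Finset.mem_filter.mpr ⟨Finset.mem_univ v, e, Finset.mem_filter.mpr ⟨he, hv⟩⟩
  have h1 := sum_card_filter_mem hE.1 hmem
  have h2 : ∑ v ∈ X, 4 ≤ ∑ v ∈ X, (E.filter (v ∈ ·)).card :=
    Finset.sum_le_sum fun v hv => hcon v (Finset.mem_filter.mp hv).2
  have h3 : inside E X = E := by
    ext e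
    rw [mem_inside]
    exact ⟨fun h => h.1, fun h => ⟨h, hmem e h⟩⟩
  have h4 : 2 ≤ X.card := by
    obtain ⟨e, he⟩ := hn
    have hd := hE.1 e he
    have hv := hmem e he
    induction e with
    | h a b =>
      have hab : a ≠ b := by simpa using hd
      rw [← Finset.card_pair hab]
      refine Finset.card_le_card fun x hx => hv x ?_
      simpa using hx
  have h5 := hE.2 X h4
  rw [h3] at h5
  rw [Finset.sum_const, smul_eq_mul] at h2
  omega

end Sparse

/-! ### Generic configurations -/

section Generic

variable {V : Type*}

/-- The signed area of a triangle is a nonzero polynomial in the coordinates of its vertices. -/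
theorem IsGeneric.inGeneralPosition {p : Configuration V} (hp : IsGeneric p) :
    InGeneralPosition p := by
  classical
  intro z x y hzx hzy hxy hcol
  rw [collinear_iff_area_eq_zero] at hcol
  let P : MvPolynomial (V × Fin 2) ℚ :=
    (MvPolynomial.X (x, 0) - MvPolynomial.X (z, 0)) *
      (MvPolynomial.X (y, 1) - MvPolynomial.X (z, 1)) -
    (MvPolynomial.X (x, 1) - MvPolynomial.X (z, 1)) *
      (MvPolynomial.X (y, 0) - MvPolynomial.X (z, 0))
  have hP : P = 0 := by
    refine hp ?_
    rw [map_zero, ← hcol]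
    simp [P, area]
  have h1 : MvPolynomial.eval
      (fun c : V × Fin 2 => if c = (x, 0) ∨ c = (y, 1) then (1 : ℚ) else 0) P = 1 := by
    simp [P, hzx, hzy, hxy, hxy.symm]
  rw [hP, map_zero] at h1
  exact zero_ne_one h1

theorem IsGeneric.injective {p : Configuration V} (hp : IsGeneric p) : Function.Injective p := by
  intro x y hxy
  have h := AlgebraicIndependent.injective hp (a₁ := (x, 0)) (a₂ := (y, 0)) (by simp [hxy])
  exact congrArg Prod.fst h

variable [Fintype V]

/-- Edges that are independent in some configuration are independent in every generic one. -/
theorem IsGeneric.stressSpace_eq_bot {p q : Configuration V} (hp : IsGeneric p)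
    {E : Finset (Sym2 V)} (hE : ∀ e ∈ E, ¬ e.IsDiag) (hq : stressSpace q E = ⊥) :
    stressSpace p E = ⊥ := by
  classical
  obtain ⟨G, hG⟩ : ∃ G : SimpleGraph V, ∀ e, e ∈ G.edgeSet ↔ e ∈ E := by
    refine ⟨SimpleGraph.fromEdgeSet (E : Set (Sym2 V)), fun e => ?_⟩
    simp only [SimpleGraph.edgeSet_fromEdgeSet, Set.mem_sdiff, Finset.mem_coe]
    exact ⟨fun h => h.1, fun h => ⟨h, hE e h⟩⟩
  have h1 := rigidityRank_add_finrank_stressSpace G p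
  have h2 := rigidityRank_add_finrank_stressSpace G q
  have h3 := hp.rigidityRank_le G q
  rw [show G.edgeFinset = E from Finset.ext fun e => by rw [SimpleGraph.mem_edgeFinset, hG]]
    at h1 h2
  rw [hq, finrank_bot] at h2
  exact Submodule.finrank_eq_zero.mp (by omega)

end Generic

/-! ### Sparse edge sets are generically independent -/

section Laman

variable {V : Type*} [Fintype V]

open Classical in
/-- The geometric half of Laman's theorem for a vertex `v` of degree 3: when `v` is moved to the
midpoint of its neighbours `a` and `b`, the edge to `c` carries no stress, and the edges to `a` and `b`
carry the same stress as a single edge `a b` would. -/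
theorem stressSpace_update_midpoint_eq_bot {p : Configuration V} (hp : InGeneralPosition p)
    (hinj : Function.Injective p) {E : Finset (Sym2 V)} {v a b c : V} (hav : a ≠ v) (hbv : b ≠ v)
    (hcv : c ≠ v) (hab : a ≠ b) (hac : a ≠ c) (hbc : b ≠ c)
    (hE : E.filter (v ∈ ·) = {s(v, a), s(v, b), s(v, c)}) (hnot : s(a, b) ∉ E.filter (v ∉ ·))
    (h : stressSpace p (insert s(a, b) (E.filter (v ∉ ·))) = ⊥) :
    stressSpace (Function.update p v ((1 / 2 : ℝ) • (p a + p b))) E = ⊥ := by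
  set q := Function.update p v ((1 / 2 : ℝ) • (p a + p b)) with hq
  have hqv (i : Fin 2) : q v i = (p a i + p b i) / 2 := by
    simp [hq]; ring
  have hqu {u : V} (hu : u ≠ v) : q u = p u := by simp [hq, hu]
  rw [eq_bot_iff]
  intro ω hω
  rw [Submodule.mem_bot]
  have hE0 {u : V} (hu : u ≠ a) (hu' : u ≠ b) (hu'' : u ≠ c) : ω s(v, u) = 0 := by
    refine hω.1 _ fun hmem => ?_
    have : s(v, u) ∈ E.filter (v ∈ ·) := by simp [hmem]
    rw [hE] at this
    simp only [Finset.mem_insert, Finset.mem_singleton, Sym2.congr_right] at this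
    tauto
  have hωab : ω s(a, b) = 0 := hω.1 _ fun hmem => hnot (by simp [hmem, hav.symm, hbv.symm])
  have heq (i : Fin 2) : (ω s(v, a) - ω s(v, b)) * ((p b i - p a i) / 2) +
      ω s(v, c) * ((p a i + p b i) / 2 - p c i) = 0 := by
    have h1 := hω.2 v i
    have h2 : ∑ u ∈ {a, b, c}, ω s(v, u) * (q v i - q u i) = 0 := by
      rw [← h1]
      refine Finset.sum_subset (Finset.subset_univ _) fun u _ hu => ?_
      simp only [Finset.mem_insert, Finset.mem_singleton, not_or] at hu
      rw [hE0 hu.1 hu.2.1 hu.2.2, zero_mul]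
    rw [Finset.sum_insert (by simp [hab, hac]), Finset.sum_insert (by simpa using hbc),
      Finset.sum_singleton, hqv, hqu hav, hqu hbv, hqu hcv] at h2
    linarith
  have hγ : ω s(v, c) = 0 := by
    have h3 : ω s(v, c) * area (p a) (p b) (p c) = 0 := by
      have h0 := heq 0
      have h1 := heq 1
      unfold area
      linear_combination (p b 1 - p a 1) * h0 - (p b 0 - p a 0) * h1
    refine (mul_eq_zero.mp h3).resolve_right fun h4 => ?_
    exact hp a b c hab hac hbc ((collinear_iff_area_eq_zero _ _ _).mpr h4)
  have hαβ : ω s(v, b) = ω s(v, a) := by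
    by_contra hne
    apply hab
    apply hinj
    ext i
    have h0 := heq i
    rw [hγ, zero_mul, add_zero] at h0
    have := (mul_eq_zero.mp h0).resolve_left fun h => hne (sub_eq_zero.mp h).symm
    linarith
  set α := ω s(v, a) with hα
  let ω' : Sym2 V → ℝ := fun e => if v ∈ e then 0 else if e = s(a, b) then α / 2 else ω e
  have hω' : ω' ∈ stressSpace p (insert s(a, b) (E.filter (v ∉ ·))) := by
    refine ⟨fun e he => ?_, fun w i => ?_⟩
    · simp only [Finset.mem_insert, Finset.mem_filter, not_or, not_and, not_not] at he
      by_cases hve : v ∈ e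
      · simp [ω', hve]
      · simp only [ω', hve, he.1, if_false]
        exact hω.1 e fun h' => hve (he.2 h')
    by_cases hwv : w = v
    · subst hwv
      simp [ω']
    have key (u : V) : ω' s(w, u) * (p w i - p u i) = ω s(w, u) * (q w i - q u i) +
        ((if u = v then (if w = a ∨ w = b then -α * (p w i - (p a i + p b i) / 2) else 0) else 0) +
        ((if u = b then (if w = a then α / 2 * (p a i - p b i) else 0) else 0) +
        (if u = a then (if w = b then α / 2 * (p b i - p a i) else 0) else 0))) := by
      rw [hqu hwv]
      by_cases huv : u = v
      · subst huv
        rw [hqv]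
        have h1 : ω' s(w, u) = 0 := by simp [ω']
        rw [h1, Sym2.eq_swap]
        simp only [if_true, hav.symm, hbv.symm, if_false]
        by_cases hwa : w = a
        · subst hwa; simp [hα]
        · by_cases hwb : w = b
          · subst hwb; simp [hαβ]
          · have : ω s(u, w) = 0 := by
              by_cases hwc : w = c
              · rw [hwc, hγ]
              · exact hE0 hwa hwb hwc
            simp [hwa, hwb, this]
      · rw [hqu huv]
        have h1 : v ∉ s(w, u) := by
          simp only [Sym2.mem_iff, not_or]
          exact ⟨Ne.symm hwv, Ne.symm huv⟩
        simp only [ω', h1, huv, if_false]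
        by_cases h2 : s(w, u) = s(a, b)
        · rw [if_pos h2, h2, hωab]
          rw [Sym2.eq_iff] at h2
          rcases h2 with ⟨rfl, rfl⟩ | ⟨rfl, rfl⟩
          · simp [hab.symm]
          · simp [hab]
        · rw [if_neg h2]
          have h3 : ¬ (u = b ∧ w = a) := by rintro ⟨rfl, rfl⟩; exact h2 rfl
          have h4 : ¬ (u = a ∧ w = b) := by rintro ⟨rfl, rfl⟩; exact h2 Sym2.eq_swap
          simp only [← ite_and, h3, h4, if_false, add_zero]
    rw [Finset.sum_congr rfl fun u _ => key u, Finset.sum_add_distrib, hω.2 w i,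
      Finset.sum_add_distrib, Finset.sum_add_distrib]
    simp only [Finset.sum_ite_eq', Finset.mem_univ, if_true, zero_add]
    by_cases hwa : w = a
    · subst hwa
      simp [hab]; ring
    · by_cases hwb : w = b
      · subst hwb
        simp [hwa]; ring
      · simp [hwa, hwb]
  rw [h, Submodule.mem_bot] at hω'
  have hα0 : α = 0 := by
    have h1 := congrFun hω' s(a, b)
    simp only [ω', Sym2.mem_iff, hav.symm, hbv.symm, or_self, if_false, if_true,
      Pi.zero_apply] at h1
    linarith
  funext e
  by_cases hve : v ∈ e
  · obtain ⟨u, rfl⟩ := Sym2.mem_iff_exists.mp hve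
    by_cases hua : u = a
    · rw [hua, ← hα, hα0]; rfl
    by_cases hub : u = b
    · rw [hub, hαβ, hα0]; rfl
    by_cases huc : u = c
    · rw [huc, hγ]; rfl
    · exact hE0 hua hub huc
  · by_cases he : e = s(a, b)
    · rw [he, hωab]; rfl
    · have h1 := congrFun hω' e
      simpa only [ω', hve, he, if_false] using h1

open Classical in
/-- The sufficiency half of Laman's theorem: a sparse edge set is independent in every generic
configuration. -/
theorem IsSparse.stressSpace_eq_bot (hV : 2 < Fintype.card V) {E : Finset (Sym2 V)}
    (hE : IsSparse E) {p : Configuration V} (hp : IsGeneric p) : stressSpace p E = ⊥ := by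
  induction hn : E.card using Nat.strong_induction_on generalizing E with
  | _ n ih =>
    rcases E.eq_empty_or_nonempty with rfl | hne
    · rw [eq_bot_iff]
      intro ω hω
      exact funext fun e => hω.1 e (Finset.notMem_empty e)
    obtain ⟨v, hv, hv3⟩ := hE.exists_degree_le_three hne
    have hcard := Finset.card_filter_add_card_filter_not (s := E) (v ∈ ·)
    have hpos := Finset.card_pos.mpr hv
    rcases Nat.lt_or_ge (E.filter (v ∈ ·)).card 3 with hlt | hge
    · have h1 : stressSpace p (E.filter (v ∉ ·)) = ⊥ :=
        ih _ (by omega) (hE.mono (Finset.filter_subset _ _)) rfl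
      rw [eq_bot_iff, ← h1]
      intro ω hω
      have h0 : ∀ y, y ≠ v → ω s(v, y) = 0 := by
        intro y hy
        refine stress_eq_zero_of_card_cut_le_two hp.inGeneralPosition hV hω {v} ?_
          (Finset.mem_singleton_self v) (by simpa using hy)
        refine le_trans ?_ (Nat.lt_succ_iff.mp hlt)
        refine Finset.card_le_card_of_injOn (fun q => s(q.1, q.2)) ?_ ?_
        · rintro ⟨a, b⟩ hq
          simp only [Finset.coe_filter, Finset.mem_product, Finset.mem_singleton,
            Set.mem_ofPred_eq] at hq
          obtain ⟨⟨rfl, -⟩, hq⟩ := hq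
          refine Finset.mem_coe.mpr (Finset.mem_filter.mpr ⟨?_, by simp⟩)
          by_contra h
          exact hq (hω.1 _ h)
        · rintro ⟨a, b⟩ hq ⟨a', b'⟩ hq' heq
          simp only [Finset.coe_filter, Finset.mem_product, Finset.mem_singleton,
            Set.mem_ofPred_eq] at hq hq'
          obtain ⟨⟨rfl, -⟩, -⟩ := hq
          obtain ⟨⟨rfl, -⟩, -⟩ := hq'
          have hb : b = b' := Sym2.congr_right.mp heq
          rw [hb]
      refine ⟨fun e he => ?_, hω.2⟩
      by_cases hve : v ∈ e
      · obtain ⟨u, rfl⟩ := Sym2.mem_iff_exists.mp hve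
        by_cases huv : u = v
        · exact hω.1 _ fun hmem => hE.1 _ hmem (by simp [huv])
        · exact h0 u huv
      · exact hω.1 _ fun hmem => he (Finset.mem_filter.mpr ⟨hmem, hve⟩)
    · obtain ⟨a, b, c, hav, hbv, hcv, hab, hac, hbc, hfil, hnot, hsp⟩ :=
        hE.exists_reduction (le_antisymm hv3 hge)
      have h1 := ih _ (by rw [Finset.card_insert_of_notMem hnot]; omega) hsp rfl
      exact hp.stressSpace_eq_bot hE.1 (stressSpace_update_midpoint_eq_bot hp.inGeneralPosition
        hp.injective hav hbv hcv hab hac hbc hfil hnot h1)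

end Laman

/-! ### Generic rank of 3-edge-connected 4-valent graphs -/

section FourValent

variable {V : Type*} [Fintype V] {G : SimpleGraph V}

omit [Fintype V] in
open Classical in
theorem cutCard_comm (X Y : Finset V) : cutCard G X Y = cutCard G Y X := by
  simp only [cutCard, degIn, Finset.card_filter]
  rw [Finset.sum_comm]
  simp only [G.adj_comm]

open Classical in
/-- A proper vertex set with at least two vertices that spans one edge more than a sparse set may. In
a 3-edge-connected 4-valent graph these are the sets of at least two vertices that are surrounded by
a cut of exactly four edges. -/
def IsCritical (G : SimpleGraph V) (X : Finset V) : Prop :=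
  2 ≤ X.card ∧ X ≠ Finset.univ ∧ (inside G.edgeFinset X).card + 2 = 2 * X.card

open Classical in
theorem card_inside_add_two_le (hG : IsFourValent G) (hC : IsThreeEdgeConnectedOn G Finset.univ)
    {X : Finset V} (hn : X.Nonempty) (hne : X ≠ Finset.univ) :
    (inside G.edgeFinset X).card + 2 ≤ 2 * X.card := by
  have h1 := two_mul_card_inside_add_cutCard hG X
  have h2 := hC.2 X (Finset.subset_univ X) hn hne
  rw [← Finset.compl_eq_univ_sdiff] at h2
  omega

open Classical in
theorem card_inside_compl (hG : IsFourValent G) {X : Finset V}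
    (hX : (inside G.edgeFinset X).card + 2 = 2 * X.card) :
    (inside G.edgeFinset Xᶜ).card + 2 = 2 * Xᶜ.card := by
  have h1 := two_mul_card_inside_add_cutCard hG X
  have h2 := two_mul_card_inside_add_cutCard hG Xᶜ
  rw [compl_compl, cutCard_comm] at h2
  omega

open Classical in
theorem IsCritical.four_le_card {X : Finset V} (hX : IsCritical G X) : 4 ≤ X.card := by
  have h1 := sum_degIn_eq_two_mul G X
  have h2 : ∑ x ∈ X, degIn G X x ≤ ∑ _x ∈ X, (X.card - 1) :=
    Finset.sum_le_sum fun x hx => Nat.le_sub_one_of_lt (degIn_lt_card G hx)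
  rw [Finset.sum_const, smul_eq_mul] at h2
  have h3 := hX.1
  have h4 := hX.2.2
  by_contra hcon
  have : X.card = 2 ∨ X.card = 3 := by omega
  rcases this with h | h <;> rw [h] at h2 h4 <;> omega

open Classical in
theorem card_inside_erase {X : Finset V} {v : V} (hv : v ∈ X) :
    (inside G.edgeFinset (X.erase v)).card + degIn G X v = (inside G.edgeFinset X).card := by
  rw [degIn_eq_card_filter_inside G hv, add_comm,
    ← Finset.card_filter_add_card_filter_not (s := inside G.edgeFinset X) (v ∈ ·)]
  congr 2
  ext e
  simp only [mem_inside, Finset.mem_filter, Finset.mem_erase]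
  refine ⟨fun h => ⟨⟨h.1, fun u hu => (h.2 u hu).2⟩, fun hve => (h.2 v hve).1 rfl⟩,
    fun h => ⟨h.1.1, fun u hu => ⟨?_, h.1.2 u hu⟩⟩⟩
  rintro rfl
  exact h.2 hu

open Classical in
/-- Uncrossing: minimal critical sets that meet are complements of single vertices. -/
theorem card_of_minimal_critical (hG : IsFourValent G)
    (hC : IsThreeEdgeConnectedOn G Finset.univ) {X Y : Finset V} (hX : IsCritical G X)
    (hY : IsCritical G Y) (hXmin : ∀ Z ⊂ X, ¬ IsCritical G Z) (hYmin : ∀ Z ⊂ Y, ¬ IsCritical G Z)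
    (hne : X ≠ Y) (hmeet : (X ∩ Y).Nonempty) : Xᶜ.card = 1 := by
  have hss : X ∩ Y ⊂ X := by
    refine Finset.inter_subset_left.ssubset_of_ne fun h => ?_
    have hXY : X ⊆ Y := Finset.inter_eq_left.mp h
    exact hYmin X (hXY.ssubset_of_ne hne) hX
  have hXc : Xᶜ.Nonempty := by
    rw [Finset.nonempty_iff_ne_empty, Ne, Finset.compl_eq_empty_iff]
    exact hX.2.1
  have hsup := card_inside_add_card_inside_le G.edgeFinset X Y
  have hcard := Finset.card_union_add_card_inter X Y
  have hX2 := hX.2.2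
  have hY2 := hY.2.2
  have hIne : X ∩ Y ≠ Finset.univ := fun h => hX.2.1
    (Finset.univ_subset_iff.mp (h ▸ Finset.inter_subset_left))
  by_cases hU : X ∪ Y = Finset.univ
  · -- the complement of `X` lies in `Y` and is again surrounded by four edges
    by_contra h1
    refine hYmin Xᶜ ?_ ⟨?_, ?_, card_inside_compl hG hX.2.2⟩
    · refine Finset.ssubset_iff_subset_ne.mpr ⟨fun x hx => ?_, fun h => ?_⟩
      · have : x ∈ X ∪ Y := hU ▸ Finset.mem_univ x
        exact (Finset.mem_union.mp this).resolve_left (Finset.mem_compl.mp hx)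
      · obtain ⟨x, hx⟩ := hmeet
        rw [Finset.mem_inter, ← h, Finset.mem_compl] at hx
        exact hx.2 hx.1
    · have := Finset.card_pos.mpr hXc
      omega
    · intro h
      rw [Finset.compl_eq_univ_iff] at h
      have := hX.1
      simp [h] at this
  · exfalso
    have hUn : (X ∪ Y).Nonempty := hmeet.mono
      (Finset.inter_subset_left.trans Finset.subset_union_left)
    have h1 := card_inside_add_two_le hG hC hUn hU
    have h2 := card_inside_add_two_le hG hC hmeet hIne
    by_cases h3 : 2 ≤ (X ∩ Y).card
    · exact hXmin _ hss ⟨h3, hIne, by omega⟩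
    · -- a single common vertex has degree at most 2 in `X` or in `Y`, and can be removed from it
      have h4 : (X ∩ Y).card = 1 := by
        have := Finset.card_pos.mpr hmeet
        omega
      obtain ⟨v, hv⟩ := Finset.card_eq_one.mp h4
      have hvXY : v ∈ X ∩ Y := by simp [hv]
      have hvX := (Finset.mem_inter.mp hvXY).1
      have hvY := (Finset.mem_inter.mp hvXY).2
      have h5 := degIn_univ_of_isFourValent hG v
      have h6 : degIn G X v + degIn G Y v ≤ 4 := by
        rw [← h5, degIn, degIn, degIn, ← Finset.card_union_of_disjoint]
        · exact Finset.card_le_card (Finset.union_subset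
            (Finset.filter_subset_filter _ (Finset.subset_univ _))
            (Finset.filter_subset_filter _ (Finset.subset_univ _)))
        · rw [Finset.disjoint_left]
          intro u hu hu'
          rw [Finset.mem_filter] at hu hu'
          have : u ∈ X ∩ Y := Finset.mem_inter.mpr ⟨hu.1, hu'.1⟩
          rw [hv, Finset.mem_singleton] at this
          exact hu.2.ne this.symm
      have key {Z : Finset V} (hZ : IsCritical G Z) (hvZ : v ∈ Z)
          (hmin : ∀ W ⊂ Z, ¬ IsCritical G W) (hd : degIn G Z v ≤ 2) : False := by
        have h7 := card_inside_erase (G := G) hvZ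
        have h8 := hZ.four_le_card
        have h9 := Finset.card_erase_of_mem hvZ
        have h10 : Z.erase v ≠ Finset.univ := fun h => by
          have := Finset.mem_univ v
          rw [← h] at this
          simp at this
        have h11 := card_inside_add_two_le hG hC
          (Finset.card_pos.mp (show 0 < (Z.erase v).card by omega)) h10
        have h12 := hZ.2.2
        exact hmin (Z.erase v) (Finset.erase_ssubset hvZ) ⟨by omega, h10, by omega⟩
      rcases Nat.lt_or_ge 2 (degIn G X v) with h | h
      · exact key hY hvY hYmin (by omega)
      · exact key hX hvX hXmin h

open Classical in
theorem IsCritical.exists_minimal {X : Finset V} (hX : IsCritical G X) :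
    ∃ Y ⊆ X, IsCritical G Y ∧ ∀ Z ⊂ Y, ¬ IsCritical G Z := by
  induction X using Finset.strongInduction with
  | H X ih =>
    by_cases h : ∀ Z ⊂ X, ¬ IsCritical G Z
    · exact ⟨X, subset_rfl, hX, h⟩
    · push Not at h
      obtain ⟨Z, hZ, hZc⟩ := h
      obtain ⟨Y, hY, h⟩ := ih Z hZ hZc
      exact ⟨Y, hY.trans hZ.subset, h⟩

open Classical in
/-- A quarter of the number of vertices, or else three, edges meet all critical sets. -/
theorem exists_transversal (hG : IsFourValent G) (hC : IsThreeEdgeConnectedOn G Finset.univ) :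
    ∃ D ⊆ G.edgeFinset, (D.card ≤ 3 ∨ 4 * D.card ≤ Fintype.card V) ∧
      ∀ X, IsCritical G X → (inside G.edgeFinset X ∩ D).Nonempty := by
  by_cases hbig : ∃ X, IsCritical G X ∧ (∀ Z ⊂ X, ¬ IsCritical G Z) ∧ Xᶜ.card = 1
  · -- all critical sets are complements of vertices, and a path of three edges meets them all
    obtain ⟨X, hX, hXmin, hX1⟩ := hbig
    have hall : ∀ Y, IsCritical G Y → Yᶜ.card = 1 := by
      intro Y hY
      obtain ⟨Z, hZY, hZ, hZmin⟩ := hY.exists_minimal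
      have hZ1 : Zᶜ.card = 1 := by
        by_cases hne : Z = X
        · rw [hne, hX1]
        · refine card_of_minimal_critical hG hC hZ hX hZmin hXmin hne ?_
          by_contra hdis
          rw [Finset.not_nonempty_iff_eq_empty, ← Finset.disjoint_iff_inter_eq_empty] at hdis
          have h1 : Z ⊆ Xᶜ := Finset.subset_compl_iff_disjoint_right.mpr hdis
          have := Finset.card_le_card h1
          have := hZ.1
          omega
      have h2 := Finset.card_le_card (Finset.compl_subset_compl.mpr hZY)
      have h3 : Yᶜ.Nonempty := by
        rw [Finset.nonempty_iff_ne_empty, Ne, Finset.compl_eq_empty_iff]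
        exact hY.2.1
      have := Finset.card_pos.mpr h3
      omega
    have hnb (x y : V) : ∃ z, z ≠ y ∧ G.Adj x z := by
      have h4 := degIn_univ_of_isFourValent hG x
      obtain ⟨z, hz, hzy⟩ := Finset.exists_mem_ne (s := Finset.univ.filter (G.Adj x))
        (by unfold degIn at h4; omega) y
      exact ⟨z, hzy, (Finset.mem_filter.mp hz).2⟩
    obtain ⟨v, -⟩ := Finset.card_pos.mp (show 0 < X.card by have := hX.1; omega)
    obtain ⟨a, -, hva⟩ := hnb v v
    obtain ⟨b, hbv, hab⟩ := hnb a v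
    obtain ⟨c, hca, hvc⟩ := hnb v a
    refine ⟨{s(v, a), s(a, b), s(v, c)}, ?_, Or.inl Finset.card_le_three, fun Y hY => ?_⟩
    · intro e he
      simp only [Finset.mem_insert, Finset.mem_singleton] at he
      rcases he with rfl | rfl | rfl <;> simpa
    · obtain ⟨w, hw⟩ := Finset.card_eq_one.mp (hall Y hY)
      have hmem : ∀ u, u ≠ w → u ∈ Y := fun u hu => by
        by_contra hcon
        have : u ∈ Yᶜ := Finset.mem_compl.mpr hcon
        rw [hw, Finset.mem_singleton] at this
        exact hu this
      by_cases hwv : w = v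
      · exact ⟨s(a, b), Finset.mem_inter.mpr ⟨mk_mem_inside.mpr ⟨by simpa using hab,
          hmem a (hwv ▸ hva.ne'), hmem b (hwv ▸ hbv)⟩, by simp⟩⟩
      · by_cases hwa : w = a
        · exact ⟨s(v, c), Finset.mem_inter.mpr ⟨mk_mem_inside.mpr ⟨by simpa using hvc,
            hmem v (Ne.symm hwv), hmem c (hwa ▸ hca)⟩, by simp⟩⟩
        · exact ⟨s(v, a), Finset.mem_inter.mpr ⟨mk_mem_inside.mpr ⟨by simpa using hva,
            hmem v (Ne.symm hwv), hmem a (Ne.symm hwa)⟩, by simp⟩⟩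
  · -- the minimal critical sets are disjoint
    push Not at hbig
    let M : Finset (Finset V) :=
      Finset.univ.filter fun X => IsCritical G X ∧ ∀ Z ⊂ X, ¬ IsCritical G Z
    have hM {X : Finset V} : X ∈ M ↔ IsCritical G X ∧ ∀ Z ⊂ X, ¬ IsCritical G Z := by
      simp [M]
    have hdis : (M : Set (Finset V)).PairwiseDisjoint id := by
      intro X hX Y hY hne
      rw [Finset.mem_coe, hM] at hX hY
      rw [Function.onFun, id, id, Finset.disjoint_iff_inter_eq_empty]
      by_contra hmeet
      exact hbig X hX.1 hX.2 (card_of_minimal_critical hG hC hX.1 hY.1 hX.2 hY.2 hne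
        (Finset.nonempty_iff_ne_empty.mpr hmeet))
    have hcard : 4 * M.card ≤ Fintype.card V := by
      have h1 := Finset.card_biUnion hdis
      have h2 : ∑ _X ∈ M, 4 ≤ ∑ X ∈ M, (id X).card :=
        Finset.sum_le_sum fun X hX => (hM.mp hX).1.four_le_card
      have h3 : (M.biUnion id).card ≤ Fintype.card V := Finset.card_le_univ _
      rw [Finset.sum_const, smul_eq_mul] at h2
      omega
    have hex : ∀ X : Finset V, ∃ e, X ∈ M → e ∈ inside G.edgeFinset X := by
      intro X
      by_cases hX : X ∈ M
      · have h1 := (hM.mp hX).1.2.2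
        have h2 := (hM.mp hX).1.1
        obtain ⟨e, he⟩ := Finset.card_pos.mp (show 0 < (inside G.edgeFinset X).card by omega)
        exact ⟨e, fun _ => he⟩
      · obtain ⟨x⟩ : Nonempty V := by
          rw [← Fintype.card_pos_iff, ← Finset.card_univ]
          exact (Nat.zero_lt_two).trans_le hC.1
        exact ⟨s(x, x), fun h => absurd h hX⟩
    choose f hf using hex
    refine ⟨M.image f, ?_, Or.inr ?_, fun X hX => ?_⟩
    · intro e he
      obtain ⟨X, hX, rfl⟩ := Finset.mem_image.mp he
      exact inside_subset _ _ (hf X hX)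
    · have : (M.image f).card ≤ M.card := Finset.card_image_le
      omega
    · obtain ⟨Y, hYX, hY⟩ := hX.exists_minimal
      have hYM : Y ∈ M := hM.mpr hY
      exact ⟨f Y, Finset.mem_inter.mpr ⟨inside_mono _ hYX (hf Y hYM),
        Finset.mem_image_of_mem f hYM⟩⟩

open Classical in
/-- Deleting a transversal of the critical sets leaves a sparse edge set, and each deleted edge
accounts for at most one dimension of stresses. -/
theorem four_mul_finrank_stressIn_univ_le {p : Configuration V} (hp : IsGeneric p)
    (hG : IsFourValent G) (hC : IsThreeEdgeConnectedOn G Finset.univ) :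
    4 * Module.finrank ℝ (stressIn G p Finset.univ) ≤ Fintype.card V + 7 := by
  obtain ⟨D₀, hD₀E, hD₀, hD₀hit⟩ := exists_transversal hG hC
  have h2 := hC.1
  rw [Finset.card_univ] at h2
  obtain ⟨v⟩ : Nonempty V := Fintype.card_pos_iff.mp (by omega)
  have hV := four_lt_card_of_isFourValent hG v
  have hEcard := card_edgeFinset_of_isFourValent hG
  have hD₀' := Finset.card_le_card hD₀E
  obtain ⟨D, hD₀D, hDE, hD⟩ := Finset.exists_subsuperset_card_eq hD₀E
    (n := max D₀.card 3) (le_max_left _ _) (by omega)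
  have hsp : IsSparse (G.edgeFinset \ D) := by
    refine ⟨fun e he => G.not_isDiag_of_mem_edgeFinset (Finset.mem_sdiff.mp he).1,
      fun X hX => ?_⟩
    by_cases hXu : X = Finset.univ
    · have h3 := Finset.card_le_card (inside_subset (G.edgeFinset \ D) X)
      rw [Finset.card_sdiff_of_subset hDE] at h3
      rw [hXu, Finset.card_univ]
      rw [hXu] at h3
      omega
    · have h3 := card_inside_add_two_le hG hC (Finset.card_pos.mp (by omega)) hXu
      have h4 : inside (G.edgeFinset \ D) X ⊆ inside G.edgeFinset X :=
        inside_mono_left Finset.sdiff_subset X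
      by_cases hcr : IsCritical G X
      · obtain ⟨e, he⟩ := hD₀hit X hcr
        rw [Finset.mem_inter] at he
        have h5 : inside (G.edgeFinset \ D) X ⊂ inside G.edgeFinset X := by
          refine h4.ssubset_of_ne fun h => ?_
          have h6 := he.1
          rw [← h] at h6
          exact (Finset.mem_sdiff.mp (inside_subset _ _ h6)).2 (hD₀D he.2)
        have := Finset.card_lt_card h5
        omega
      · have h5 : (inside G.edgeFinset X).card + 2 ≠ 2 * X.card := fun h => hcr ⟨hX, hXu, h⟩
        have := Finset.card_le_card h4
        omega
  have h3 := finrank_stressSpace_le_add_card p (E := inside G.edgeFinset Finset.univ)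
    (E' := G.edgeFinset \ D) D fun ω hω h0 => ⟨fun e he => by
      by_cases heD : e ∈ D
      · exact h0 e heD
      · exact hω.1 e fun h => he (Finset.mem_sdiff.mpr ⟨inside_subset _ _ h, heD⟩), hω.2⟩
  rw [hsp.stressSpace_eq_bot (by omega) hp, finrank_bot] at h3
  rw [stressIn]
  omega

end FourValent

/-! ### Upper bounds on the rank from infinitesimal motions -/

section Motions

variable {V : Type*} [Fintype V]

theorem rigidityMatrix_mulVec (G : SimpleGraph V) (p : Configuration V) (u : V × Fin 2 → ℝ)
    {x y : V} (h : s(x, y) ∈ G.edgeSet) :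
    (rigidityMatrix G p).mulVec u ⟨s(x, y), h⟩ =
      ∑ i, (p x i - p y i) * (u (x, i) - u (y, i)) := by
  classical
  simp only [Matrix.mulVec, dotProduct, rigidityMatrix, Matrix.of_apply, rigidityEntry,
    Sym2.lift_mk, Fintype.sum_prod_type]
  rw [Finset.sum_comm]
  refine Finset.sum_congr rfl fun i _ => ?_
  simp only [add_mul, Finset.sum_add_distrib, ite_mul, zero_mul, Finset.sum_ite_eq',
    Finset.mem_univ, if_true]
  ring

/-- A space of `|α|` velocity fields of which `|β|` linear conditions single out infinitesimal motions
bounds the rank of the framework from above. -/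
theorem rigidityRank_add_card_le {G : SimpleGraph V} {p : Configuration V} {α β : Type*} [Fintype α]
    [Fintype β] (Φ : (α → ℝ) →ₗ[ℝ] (V × Fin 2 → ℝ)) (Ψ : (α → ℝ) →ₗ[ℝ] (β → ℝ))
    (hΦ : ∀ w, Φ w = 0 → w = 0)
    (h : ∀ w, Ψ w = 0 → ∀ x y, G.Adj x y →
      ∑ i, (p x i - p y i) * (Φ w (x, i) - Φ w (y, i)) = 0) :
    rigidityRank G p + Fintype.card α ≤ 2 * Fintype.card V + Fintype.card β := by
  have h1 := LinearMap.finrank_range_add_finrank_ker (rigidityMatrix G p).mulVecLin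
  have h2 := LinearMap.finrank_range_add_finrank_ker Ψ
  have h3 := Submodule.finrank_le (LinearMap.range Ψ)
  rw [Module.finrank_fintype_fun_eq_card] at h1 h2 h3
  rw [Fintype.card_prod, Fintype.card_fin] at h1
  have h4 : Module.finrank ℝ (LinearMap.ker Ψ) ≤
      Module.finrank ℝ (LinearMap.ker (rigidityMatrix G p).mulVecLin) := by
    let g : LinearMap.ker Ψ →ₗ[ℝ] LinearMap.ker (rigidityMatrix G p).mulVecLin :=
      (Φ.comp (LinearMap.ker Ψ).subtype).codRestrict _ fun w => by
        rw [LinearMap.mem_ker, Matrix.mulVecLin_apply]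
        funext ⟨e, he⟩
        induction e with
        | h x y =>
          rw [rigidityMatrix_mulVec]
          exact h w.1 w.2 x y he
    refine LinearMap.finrank_le_finrank_of_injective (f := g) ?_
    rw [← LinearMap.ker_eq_bot, LinearMap.ker_eq_bot']
    intro w hw
    exact Subtype.ext (hΦ _ (congrArg (fun z => z.1) hw))
  unfold rigidityRank Matrix.rank
  omega

end Motions

/-! ### Rings of blocks -/

open Classical in
theorem isFourValent_of_card_filter {V : Type*} [Fintype V] {G : SimpleGraph V}
    (h : ∀ x, (Finset.univ.filter (G.Adj x)).card = 4) : IsFourValent G := by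
  intro x
  rw [← SimpleGraph.card_neighborFinset_eq_degree, ← h x]
  congr 1
  ext y
  simp

section Ring

variable {m k r : ℕ}

/-- A cyclic sequence of `m` blocks, each of which is the graph `B` on `k` vertices, with `r` edges
from every block to the next one: the `c`-th of them joins the vertex `src c` to the vertex `tgt c`
of the next block. -/
def ringGraph (m : ℕ) (B : Fin k → Fin k → Prop) (src tgt : Fin r → Fin k) :
    SimpleGraph (ZMod m × Fin k) :=
  SimpleGraph.fromRel fun x y =>
    (x.1 = y.1 ∧ B x.2 y.2) ∨ (y.1 = x.1 + 1 ∧ ∃ c, src c = x.2 ∧ tgt c = y.2)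

theorem zmod_one_ne_zero (hm : 3 ≤ m) : (1 : ZMod m) ≠ 0 := by
  intro h
  have : ((1 : ℕ) : ZMod m) = 0 := by exact_mod_cast h
  rw [ZMod.natCast_eq_zero_iff] at this
  have := Nat.le_of_dvd (by norm_num) this
  omega

theorem zmod_two_ne_zero (hm : 3 ≤ m) : (2 : ZMod m) ≠ 0 := by
  intro h
  have : ((2 : ℕ) : ZMod m) = 0 := by exact_mod_cast h
  rw [ZMod.natCast_eq_zero_iff] at this
  have := Nat.le_of_dvd (by norm_num) this
  omega

variable {B : Fin k → Fin k → Prop} {src tgt : Fin r → Fin k}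

theorem ringGraph_adj_block {i : ZMod m} {a b : Fin k} (hab : a ≠ b) (h : B a b) :
    (ringGraph m B src tgt).Adj (i, a) (i, b) := by
  simp [ringGraph, SimpleGraph.fromRel_adj, hab, h]

theorem ringGraph_adj_link (hm : 3 ≤ m) (i : ZMod m) (c : Fin r) :
    (ringGraph m B src tgt).Adj (i, src c) (i + 1, tgt c) := by
  rw [ringGraph, SimpleGraph.fromRel_adj]
  refine ⟨fun h => zmod_one_ne_zero hm ?_, Or.inl (Or.inr ⟨rfl, c, rfl, rfl⟩)⟩
  simpa using congrArg Prod.fst h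

/-- A symmetric property holds for all edges of a ring if it does so inside the blocks and for the
edges that link consecutive blocks. -/
theorem ringGraph_adj_induction {P : ZMod m × Fin k → ZMod m × Fin k → Prop}
    (hsymm : ∀ x y, P x y → P y x) (hblock : ∀ i a b, P (i, a) (i, b))
    (hlink : ∀ i c, P (i, src c) (i + 1, tgt c)) {x y : ZMod m × Fin k}
    (h : (ringGraph m B src tgt).Adj x y) : P x y := by
  have key (x y : ZMod m × Fin k) (h : (x.1 = y.1 ∧ B x.2 y.2) ∨
      (y.1 = x.1 + 1 ∧ ∃ c, src c = x.2 ∧ tgt c = y.2)) : P x y := by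
    obtain ⟨i, a⟩ := x
    obtain ⟨j, b⟩ := y
    rcases h with ⟨rfl, -⟩ | ⟨rfl, c, rfl, rfl⟩
    · exact hblock _ _ _
    · exact hlink _ _
  rw [ringGraph, SimpleGraph.fromRel_adj] at h
  rcases h.2 with h | h
  · exact key x y h
  · exact hsymm _ _ (key y x h)

open Classical in
theorem isFourValent_ringGraph [NeZero m] (hm : 3 ≤ m) (hsymm : ∀ a b, B a b → B b a)
    (hirr : ∀ a, ¬ B a a) (hdeg : ∀ a, (Finset.univ.filter (B a)).card +
      (Finset.univ.filter fun b => ∃ c, src c = a ∧ tgt c = b).card +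
      (Finset.univ.filter fun b => ∃ c, src c = b ∧ tgt c = a).card = 4) :
    IsFourValent (ringGraph m B src tgt) := by
  refine isFourValent_of_card_filter fun x => ?_
  obtain ⟨i, a⟩ := x
  have h1 := zmod_one_ne_zero hm
  have h2 := zmod_two_ne_zero hm
  have hA : Finset.univ.filter ((ringGraph m B src tgt).Adj (i, a)) =
      ({i} ×ˢ Finset.univ.filter (B a) ∪
        {i + 1} ×ˢ Finset.univ.filter fun b => ∃ c, src c = a ∧ tgt c = b) ∪
        {i - 1} ×ˢ Finset.univ.filter fun b => ∃ c, src c = b ∧ tgt c = a := by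
    ext ⟨j, b⟩
    simp only [Finset.mem_union, Finset.mem_product, Finset.mem_singleton, Finset.mem_filter,
      Finset.mem_univ, true_and]
    rw [ringGraph, SimpleGraph.fromRel_adj]
    simp only
    constructor
    · rintro ⟨-, (⟨rfl, h⟩ | ⟨rfl, h⟩) | (⟨rfl, h⟩ | ⟨rfl, h⟩)⟩
      · exact Or.inl (Or.inl ⟨rfl, h⟩)
      · exact Or.inl (Or.inr ⟨rfl, h⟩)
      · exact Or.inl (Or.inl ⟨rfl, hsymm _ _ h⟩)
      · exact Or.inr ⟨by ring, h⟩
    · rintro ((⟨rfl, h⟩ | ⟨rfl, h⟩) | ⟨rfl, h⟩)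
      · refine ⟨fun h' => hirr a ?_, Or.inl (Or.inl ⟨rfl, h⟩)⟩
        rw [Prod.mk.injEq] at h'
        rwa [← h'.2] at h
      · refine ⟨fun h' => h1 ?_, Or.inl (Or.inr ⟨rfl, h⟩)⟩
        simpa using congrArg Prod.fst h'
      · refine ⟨fun h' => h1 ?_, Or.inr (Or.inr ⟨by ring, h⟩)⟩
        simpa [eq_sub_iff_add_eq] using congrArg Prod.fst h'
  have hd {i j : ZMod m} (hij : i ≠ j) (S T : Finset (Fin k)) :
      Disjoint ({i} ×ˢ S) ({j} ×ˢ T) :=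
    Finset.disjoint_product.mpr (Or.inl (by simpa using hij))
  rw [← hdeg a, hA, Finset.card_union_of_disjoint, Finset.card_union_of_disjoint]
  · simp only [Finset.card_product, Finset.card_singleton, one_mul]
  · exact hd (fun h => h1 (by simpa using h)) _ _
  · refine Finset.disjoint_union_left.mpr ⟨hd (fun h => h1 (by linear_combination h)) _ _,
      hd (fun h => h2 ?_) _ _⟩
    linear_combination h

variable {U : Finset (ZMod m × Fin k)}

/-- Blocks `s, s + 1, …, s + l` that remain internally connected and consecutively linked after the
deletion of `U` stay connected. -/
theorem preconnected_of_links (hm : 3 ≤ m) (s : ZMod m) (l : ℕ)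
    (hcover : ∀ x, x ∉ U → ∃ t ≤ l, x.1 = s + (t : ℕ))
    (hblock : ∀ x y : {v | v ∉ U}, x.1.1 = y.1.1 →
      ((ringGraph m B src tgt).induce {v | v ∉ U}).Reachable x y)
    (hlink : ∀ t < l, ∃ c, (s + (t : ℕ), src c) ∉ U ∧ (s + (t : ℕ) + 1, tgt c) ∉ U) :
    ((ringGraph m B src tgt).induce {v | v ∉ U}).Preconnected := by
  have key : ∀ t ≤ l, ∀ x y : {v | v ∉ U}, x.1.1 = s + (t : ℕ) →
      (∃ t' ≤ t, y.1.1 = s + (t' : ℕ)) →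
      ((ringGraph m B src tgt).induce {v | v ∉ U}).Reachable x y := by
    intro t
    induction t with
    | zero =>
      rintro - x y hx ⟨t', ht', hy⟩
      obtain rfl : t' = 0 := by omega
      exact hblock x y (hx.trans hy.symm)
    | succ t ih =>
      rintro ht x y hx ⟨t', ht', hy⟩
      rcases Nat.lt_or_ge t t' with h | h
      · obtain rfl : t' = t + 1 := by omega
        exact hblock x y (hx.trans hy.symm)
      · obtain ⟨c, hc1, hc2⟩ := hlink t (by omega)
        have h1 := hblock x ⟨_, hc2⟩ (by rw [hx]; push_cast; ring)
        have h2 := ih (by omega) ⟨_, hc1⟩ y rfl ⟨t', h, hy⟩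
        have h3 : ((ringGraph m B src tgt).induce {v | v ∉ U}).Adj ⟨_, hc2⟩ ⟨_, hc1⟩ :=
          (ringGraph_adj_link hm (s + (t : ℕ)) c).symm
        exact h1.trans (h3.reachable.trans h2)
  intro x y
  obtain ⟨t, ht, hx⟩ := hcover x.1 x.2
  obtain ⟨t', ht', hy⟩ := hcover y.1 y.2
  rcases Nat.le_total t t' with h | h
  · exact (key t' ht' y x hy ⟨t, h, hx⟩).symm
  · exact key t ht x y hx ⟨t', h, hy⟩

theorem add_natCast_ne [NeZero m] (i : ZMod m) {t : ℕ} (h0 : 0 < t) (ht : t < m) :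
    i + (t : ℕ) ≠ i := by
  intro h
  have h1 : ((t : ℕ) : ZMod m) = 0 := by simpa using h
  rw [ZMod.natCast_eq_zero_iff] at h1
  have := Nat.le_of_dvd h0 h1
  omega

/-- A ring stays connected if its blocks do and at most one pair of consecutive blocks loses all its
links. -/
theorem preconnected_of_subsingleton_dead [NeZero m] (hm : 3 ≤ m)
    (hblock : ∀ x y : {v | v ∉ U}, x.1.1 = y.1.1 →
      ((ringGraph m B src tgt).induce {v | v ∉ U}).Reachable x y)
    (hdead : ∀ i j : ZMod m, (∀ c, (i, src c) ∈ U ∨ (i + 1, tgt c) ∈ U) →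
      (∀ c, (j, src c) ∈ U ∨ (j + 1, tgt c) ∈ U) → i = j) :
    ((ringGraph m B src tgt).induce {v | v ∉ U}).Preconnected := by
  obtain ⟨i₀, hi₀⟩ : ∃ i₀ : ZMod m, ∀ i ≠ i₀, ∃ c, (i, src c) ∉ U ∧ (i + 1, tgt c) ∉ U := by
    by_cases h : ∃ i : ZMod m, ∀ c, (i, src c) ∈ U ∨ (i + 1, tgt c) ∈ U
    · obtain ⟨i, hi⟩ := h
      refine ⟨i, fun j hj => ?_⟩
      by_contra hcon
      push Not at hcon
      exact hj (hdead j i (fun c => or_iff_not_imp_left.mpr (hcon c)) hi)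
    · push Not at h
      exact ⟨0, fun i _ => h i⟩
  refine preconnected_of_links hm (i₀ + 1) (m - 1) (fun x _ => ?_) hblock fun t ht => hi₀ _ ?_
  · refine ⟨(x.1 - (i₀ + 1)).val, ?_, ?_⟩
    · have := ZMod.val_lt (x.1 - (i₀ + 1))
      omega
    · rw [ZMod.natCast_val, ZMod.cast_id]; ring
  · have := add_natCast_ne i₀ (t := t + 1) (by omega) (by omega)
    intro h
    apply this
    rw [← h]
    push_cast
    rw [← add_assoc] at *
    linear_combination h

/-- Moving the blocks rigidly and independently gives `3 m` dimensions of velocities, on which each of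
the `m r` links between blocks imposes one condition. -/
theorem rigidityRank_ringGraph_le [NeZero m] {p : Configuration (ZMod m × Fin k)}
    (hp : Function.Injective p) (hk : 2 ≤ k) :
    rigidityRank (ringGraph m B src tgt) p + 3 * m ≤ 2 * (m * k) + m * r := by
  let Φ : (ZMod m × Fin 3 → ℝ) →ₗ[ℝ] ((ZMod m × Fin k) × Fin 2 → ℝ) :=
    { toFun := fun w c => if c.2 = 0 then w (c.1.1, 0) - w (c.1.1, 2) * p c.1 1
        else w (c.1.1, 1) + w (c.1.1, 2) * p c.1 0
      map_add' := fun a b => by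
        funext c
        simp only [Pi.add_apply]
        split_ifs <;> ring
      map_smul' := fun t a => by
        funext c
        simp only [Pi.smul_apply, smul_eq_mul, RingHom.id_apply]
        split_ifs <;> ring }
  let Ψ : (ZMod m × Fin 3 → ℝ) →ₗ[ℝ] (ZMod m × Fin r → ℝ) :=
    { toFun := fun w d => ∑ i, (p (d.1, src d.2) i - p (d.1 + 1, tgt d.2) i) *
        (Φ w ((d.1, src d.2), i) - Φ w ((d.1 + 1, tgt d.2), i))
      map_add' := fun a b => by
        funext d
        simp only [map_add, Pi.add_apply, ← Finset.sum_add_distrib]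
        exact Finset.sum_congr rfl fun i _ => by ring
      map_smul' := fun t a => by
        funext d
        simp only [map_smul, Pi.smul_apply, smul_eq_mul, RingHom.id_apply, Finset.mul_sum]
        exact Finset.sum_congr rfl fun i _ => by ring }
  have hΦ0 (w : ZMod m × Fin 3 → ℝ) (v : ZMod m × Fin k) :
      Φ w (v, 0) = w (v.1, 0) - w (v.1, 2) * p v 1 := rfl
  have hΦ1 (w : ZMod m × Fin 3 → ℝ) (v : ZMod m × Fin k) :
      Φ w (v, 1) = w (v.1, 1) + w (v.1, 2) * p v 0 := rfl
  have h := rigidityRank_add_card_le (G := ringGraph m B src tgt) (p := p) Φ Ψ ?_ ?_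
  · simp only [Fintype.card_prod, ZMod.card, Fintype.card_fin] at h
    omega
  · intro w hw
    -- two distinct points of a block determine its velocity
    have key (i : ZMod m) : w (i, 0) = 0 ∧ w (i, 1) = 0 ∧ w (i, 2) = 0 := by
      let a : Fin k := ⟨0, by omega⟩
      let b : Fin k := ⟨1, by omega⟩
      have ha0 := congrFun hw ((i, a), 0)
      have ha1 := congrFun hw ((i, a), 1)
      have hb0 := congrFun hw ((i, b), 0)
      have hb1 := congrFun hw ((i, b), 1)
      rw [hΦ0, Pi.zero_apply] at ha0 hb0
      rw [hΦ1, Pi.zero_apply] at ha1 hb1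
      have hθ : w (i, 2) = 0 := by
        by_contra hne
        have hab : p (i, a) = p (i, b) := by
          ext j
          fin_cases j
          · refine mul_left_cancel₀ hne ?_
            simp only [Fin.zero_eta]
            linarith
          · refine mul_left_cancel₀ hne ?_
            simp only [Fin.mk_one]
            linarith
        have := hp hab
        simp [a, b] at this
      rw [hθ] at ha0 ha1
      exact ⟨by linarith, by linarith, hθ⟩
    funext ⟨i, j⟩
    fin_cases j
    · exact (key i).1
    · exact (key i).2.1
    · exact (key i).2.2
  · intro w hw x y hxy
    refine ringGraph_adj_induction (P := fun x y =>
      ∑ i, (p x i - p y i) * (Φ w (x, i) - Φ w (y, i)) = 0) ?_ ?_ ?_ hxy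
    · intro x y h
      rw [← h]
      exact Finset.sum_congr rfl fun i _ => by ring
    · intro i a b
      rw [Fin.sum_univ_two, hΦ0, hΦ0, hΦ1, hΦ1]
      ring
    · intro i c
      exact congrFun hw (i, c)

end Ring

/-! ### Three families of rings -/

section Families

variable {m : ℕ}

theorem reachable_of_block_adj {k r : ℕ} {B : Fin k → Fin k → Prop} {src tgt : Fin r → Fin k}
    {U : Finset (ZMod m × Fin k)} {i : ZMod m} {a b : Fin k} (ha : (i, a) ∉ U) (hb : (i, b) ∉ U)
    (hab : a ≠ b) (h : B a b) :
    ((ringGraph m B src tgt).induce {v | v ∉ U}).Reachable ⟨(i, a), ha⟩ ⟨(i, b), hb⟩ :=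
  SimpleGraph.Adj.reachable
    (show (ringGraph m B src tgt).Adj (i, a) (i, b) from ringGraph_adj_block hab h)

theorem reachable_of_complete_block {k r : ℕ} {src tgt : Fin r → Fin k}
    {U : Finset (ZMod m × Fin k)} (x y : {v | v ∉ U}) (h : x.1.1 = y.1.1) :
    ((ringGraph m (fun a b => a ≠ b) src tgt).induce {v | v ∉ U}).Reachable x y := by
  obtain ⟨⟨i, a⟩, hx⟩ := x
  obtain ⟨⟨j, b⟩, hy⟩ := y
  obtain rfl : i = j := h
  by_cases hab : a = b
  · subst hab; exact SimpleGraph.Reachable.refl _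
  · exact reachable_of_block_adj hx hy hab hab

/-- Blocks `K₅` minus the edge `0 4`, with a single link from the vertex 4 of every block to the
vertex 0 of the next one. -/
abbrev ringFive (m : ℕ) : SimpleGraph (ZMod m × Fin 5) :=
  ringGraph m (fun a b => a ≠ b ∧ ¬ (a = 0 ∧ b = 4) ∧ ¬ (a = 4 ∧ b = 0))
    (fun _ : Fin 1 => 4) (fun _ => 0)

/-- Blocks `K₄`, with links from the vertices 2 and 3 of every block to the vertices 0 and 1 of the
next one. -/
abbrev ringFour (m : ℕ) : SimpleGraph (ZMod m × Fin 4) :=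
  ringGraph m (fun a b => a ≠ b) (![2, 3] : Fin 2 → Fin 4) ![0, 1]

/-- Triangles, each of which is linked to the next one as in a prism. -/
abbrev ringThree (m : ℕ) : SimpleGraph (ZMod m × Fin 3) :=
  ringGraph m (fun a b => a ≠ b) (id : Fin 3 → Fin 3) id

theorem isFourValent_ringFive [NeZero m] (hm : 3 ≤ m) : IsFourValent (ringFive m) := by
  refine isFourValent_ringGraph hm (by decide) (by decide) fun a => ?_
  have h : ∀ a : Fin 5, (Finset.univ.filter fun b : Fin 5 =>
      a ≠ b ∧ ¬ (a = 0 ∧ b = 4) ∧ ¬ (a = 4 ∧ b = 0)).card +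
      (Finset.univ.filter fun b : Fin 5 => ∃ _c : Fin 1, 4 = a ∧ 0 = b).card +
      (Finset.univ.filter fun b : Fin 5 => ∃ _c : Fin 1, 4 = b ∧ 0 = a).card = 4 := by decide
  convert h a

theorem isFourValent_ringFour [NeZero m] (hm : 3 ≤ m) : IsFourValent (ringFour m) := by
  refine isFourValent_ringGraph hm (by decide) (by decide) fun a => ?_
  have h : ∀ a : Fin 4, (Finset.univ.filter fun b : Fin 4 => a ≠ b).card +
      (Finset.univ.filter fun b : Fin 4 => ∃ c : Fin 2,
        (![2, 3] : Fin 2 → Fin 4) c = a ∧ (![0, 1] : Fin 2 → Fin 4) c = b).card +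
      (Finset.univ.filter fun b : Fin 4 => ∃ c : Fin 2,
        (![2, 3] : Fin 2 → Fin 4) c = b ∧ (![0, 1] : Fin 2 → Fin 4) c = a).card = 4 := by decide
  convert h a

theorem isFourValent_ringThree [NeZero m] (hm : 3 ≤ m) : IsFourValent (ringThree m) := by
  refine isFourValent_ringGraph hm (by decide) (by decide) fun a => ?_
  have h : ∀ a : Fin 3, (Finset.univ.filter fun b : Fin 3 => a ≠ b).card +
      (Finset.univ.filter fun b : Fin 3 => ∃ c : Fin 3, id c = a ∧ id c = b).card +
      (Finset.univ.filter fun b : Fin 3 => ∃ c : Fin 3, id c = b ∧ id c = a).card = 4 := by decide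
  convert h a

theorem isVertexConnected_ringFive [NeZero m] (hm : 3 ≤ m) :
    IsVertexConnected (ringFive m) 2 := by
  intro U hU
  have hsub : ∀ u ∈ U, ∀ v ∈ U, u = v := Finset.card_le_one.mp (by omega)
  refine preconnected_of_subsingleton_dead hm ?_ fun i j hi hj => ?_
  · rintro ⟨⟨i, a⟩, ha⟩ ⟨⟨j, b⟩, hb⟩ h
    obtain rfl : i = j := h
    by_cases hab : a = b
    · subst hab; exact SimpleGraph.Reachable.refl _
    by_cases hB : ¬ (a = 0 ∧ b = 4) ∧ ¬ (a = 4 ∧ b = 0)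
    · exact reachable_of_block_adj ha hb hab ⟨hab, hB⟩
    · obtain ⟨c, hc, hcU⟩ : ∃ c : Fin 5, (c = 1 ∨ c = 2) ∧ (i, c) ∉ U := by
        by_contra hcon
        push Not at hcon
        have := hsub _ (hcon 1 (Or.inl rfl)) _ (hcon 2 (Or.inr rfl))
        simp at this
      have hmid : (a ≠ c ∧ ¬ (a = 0 ∧ c = 4) ∧ ¬ (a = 4 ∧ c = 0)) ∧
          (c ≠ b ∧ ¬ (c = 0 ∧ b = 4) ∧ ¬ (c = 4 ∧ b = 0)) := by
        have hab' : (a = 0 ∧ b = 4) ∨ (a = 4 ∧ b = 0) := by tauto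
        rcases hab' with ⟨rfl, rfl⟩ | ⟨rfl, rfl⟩ <;> rcases hc with rfl | rfl <;> decide
      exact (reachable_of_block_adj ha hcU hmid.1.1 hmid.1).trans
        (reachable_of_block_adj hcU hb hmid.2.1 hmid.2)
  · rcases hi 0 with h | h <;> rcases hj 0 with h' | h' <;> simpa using hsub _ h _ h'

theorem isVertexConnected_ringFour [NeZero m] (hm : 3 ≤ m) :
    IsVertexConnected (ringFour m) 4 := by
  classical
  intro U hU
  refine preconnected_of_subsingleton_dead hm reachable_of_complete_block fun i j hi hj => ?_
  by_contra hij
  have pick {v w : ZMod m × Fin 4} (h : v ∈ U ∨ w ∈ U) : ∃ x ∈ U, x = v ∨ x = w :=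
    h.elim (fun h => ⟨v, h, Or.inl rfl⟩) fun h => ⟨w, h, Or.inr rfl⟩
  -- the links between different pairs of consecutive blocks are disjoint, so four vertices are lost
  obtain ⟨x, hx, hx'⟩ := pick (hi 0)
  obtain ⟨y, hy, hy'⟩ := pick (hi 1)
  obtain ⟨z, hz, hz'⟩ := pick (hj 0)
  obtain ⟨w, hw, hw'⟩ := pick (hj 1)
  simp only [Matrix.cons_val_zero, Matrix.cons_val_one] at hx' hy' hz' hw'
  have hxy : x ≠ y := by rcases hx' with rfl | rfl <;> rcases hy' with rfl | rfl <;> simp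
  have hxz : x ≠ z := by rcases hx' with rfl | rfl <;> rcases hz' with rfl | rfl <;> simp [hij]
  have hxw : x ≠ w := by rcases hx' with rfl | rfl <;> rcases hw' with rfl | rfl <;> simp
  have hyz : y ≠ z := by rcases hy' with rfl | rfl <;> rcases hz' with rfl | rfl <;> simp
  have hyw : y ≠ w := by rcases hy' with rfl | rfl <;> rcases hw' with rfl | rfl <;> simp [hij]
  have hzw : z ≠ w := by rcases hz' with rfl | rfl <;> rcases hw' with rfl | rfl <;> simp
  have hcard : ({x, y, z, w} : Finset (ZMod m × Fin 4)).card = 4 := by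
    rw [Finset.card_insert_of_notMem (by simp [hxy, hxz, hxw]),
      Finset.card_insert_of_notMem (by simp [hyz, hyw]), Finset.card_pair hzw]
  have hsub : ({x, y, z, w} : Finset (ZMod m × Fin 4)) ⊆ U := by
    intro v hv
    simp only [Finset.mem_insert, Finset.mem_singleton] at hv
    rcases hv with rfl | rfl | rfl | rfl <;> assumption
  have := Finset.card_le_card hsub
  omega

theorem isVertexConnected_ringThree [NeZero m] (hm : 3 ≤ m) :
    IsVertexConnected (ringThree m) 4 := by
  classical
  intro U hU
  by_cases hdead : ∀ i j : ZMod m, (∀ c : Fin 3, (i, id c) ∈ U ∨ (i + 1, id c) ∈ U) →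
      (∀ c : Fin 3, (j, id c) ∈ U ∨ (j + 1, id c) ∈ U) → i = j
  · exact preconnected_of_subsingleton_dead hm reachable_of_complete_block hdead
  -- otherwise `U` is one of the triangles, and the others form a path
  push Not at hdead
  obtain ⟨i, j, hi, hj, hij⟩ := hdead
  have h1 := zmod_one_ne_zero hm
  have h2 := zmod_two_ne_zero hm
  have himage : U.image Prod.snd = Finset.univ := by
    rw [Finset.eq_univ_iff_forall]
    intro c
    rw [Finset.mem_image]
    rcases hi c with h | h
    · exact ⟨_, h, rfl⟩
    · exact ⟨_, h, rfl⟩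
  have hinj : Set.InjOn Prod.snd (U : Set (ZMod m × Fin 3)) := by
    rw [← Finset.card_image_iff]
    refine le_antisymm Finset.card_image_le ?_
    rw [himage, Finset.card_univ, Fintype.card_fin]
    omega
  have heq {s t : ZMod m} {c : Fin 3} (hs : (s, c) ∈ U) (ht : (t, c) ∈ U) : s = t :=
    congrArg Prod.fst (hinj hs ht rfl)
  obtain ⟨d, hd⟩ : ∃ d : ZMod m, ∀ x ∈ U, x.1 = d := by
    by_cases hji : j = i + 1
    · refine ⟨j, fun x hx => ?_⟩
      obtain ⟨s, c⟩ := x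
      rcases hj c with h | h
      · exact heq hx h
      · rcases hi c with h' | h'
        · have := heq h h'
          rw [hji] at this
          exact absurd (by linear_combination this) h2
        · rw [hji]; exact heq hx h'
    · refine ⟨i, fun x hx => ?_⟩
      obtain ⟨s, c⟩ := x
      rcases hi c with h | h
      · exact heq hx h
      · rcases hj c with h' | h'
        · exact absurd (heq h' h) hji
        · exact absurd (add_right_cancel (heq h h')) hij
  have hdU : ∀ c : Fin 3, (d, c) ∈ U := by
    intro c
    rcases hi c with h | h
    · have := hd _ h
      simp only at this
      rwa [← this]
    · have := hd _ h
      simp only at this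
      rwa [← this]
  refine preconnected_of_links hm (d + 1) (m - 2) (fun x hx => ?_) reachable_of_complete_block
    fun t ht => ⟨0, fun h => ?_, fun h => ?_⟩
  · refine ⟨(x.1 - (d + 1)).val, ?_, ?_⟩
    · have hlt := ZMod.val_lt (x.1 - (d + 1))
      by_contra hcon
      have hval : (x.1 - (d + 1)).val = m - 1 := by omega
      apply hx
      have hxd : x.1 = d := by
        have h3 : x.1 - (d + 1) = ((m - 1 : ℕ) : ZMod m) := by
          rw [← hval, ZMod.natCast_val, ZMod.cast_id]
        rw [Nat.cast_sub (by omega), ZMod.natCast_self] at h3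
        push_cast at h3
        linear_combination h3
      rw [← Prod.mk.eta (p := x), hxd]
      exact hdU _
    · rw [ZMod.natCast_val, ZMod.cast_id]; ring
  · refine add_natCast_ne d (t := t + 1) (by omega) (by omega) ?_
    have := hd _ h
    push_cast
    linear_combination this
  · refine add_natCast_ne d (t := t + 2) (by omega) (by omega) ?_
    have := hd _ h
    push_cast
    linear_combination this

/-! ### Configurations on a parabola -/

/-- The configuration that places the vertices on the parabola `y = x ^ 2`. -/
noncomputable def parabola {V : Type*} (t : V → ℝ) : Configuration V :=
  fun v => !₂[t v, t v ^ 2]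

theorem inGeneralPosition_parabola {V : Type*} {t : V → ℝ} (ht : Function.Injective t) :
    InGeneralPosition (parabola t) := by
  intro u v w huv huw hvw hcol
  rw [collinear_iff_area_eq_zero] at hcol
  have h : (t v - t u) * (t w - t u) * (t w - t v) = 0 := by
    rw [← hcol]
    simp [area, parabola]
    ring
  rcases mul_eq_zero.mp h with h | h
  · rcases mul_eq_zero.mp h with h | h
    · exact huv (ht (sub_eq_zero.mp h)).symm
    · exact huw (ht (sub_eq_zero.mp h)).symm
  · exact hvw (ht (sub_eq_zero.mp h)).symm

theorem injective_parabola {V : Type*} {t : V → ℝ} (ht : Function.Injective t) :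
    Function.Injective (parabola t) := by
  intro u v h
  have := congrArg (fun x : EuclideanSpace ℝ (Fin 2) => x 0) h
  exact ht (by simpa [parabola] using this)

/-- Parameters on the parabola for which the sum over a link does not depend on the link, so that the
three links between consecutive triangles are parallel. -/
noncomputable def prismParam (x : ZMod m × Fin 3) : ℝ :=
  5 * (x.1.val : ℝ) + (-1) ^ x.1.val * ((x.2 : ℕ) : ℝ)

theorem injective_prismParam [NeZero m] : Function.Injective (prismParam (m := m)) := by
  rintro ⟨i, a⟩ ⟨j, b⟩ h
  simp only [prismParam] at h
  have ha := a.2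
  have hb := b.2
  have h' : 5 * (i.val : ℤ) + (-1) ^ i.val * ((a : ℕ) : ℤ) =
      5 * (j.val : ℤ) + (-1) ^ j.val * ((b : ℕ) : ℤ) := by exact_mod_cast h
  have hval : i.val = j.val ∧ (a : ℕ) = b := by
    rcases neg_one_pow_eq_or ℤ i.val with h1 | h1
    · rcases neg_one_pow_eq_or ℤ j.val with h2 | h2 <;> rw [h1, h2] at h'
      · omega
      · have : i.val = j.val := by omega
        rw [this] at h1
        omega
    · rcases neg_one_pow_eq_or ℤ j.val with h2 | h2 <;> rw [h1, h2] at h'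
      · have : i.val = j.val := by omega
        rw [this] at h1
        omega
      · omega
  rw [ZMod.val_injective m hval.1, Fin.ext hval.2]

theorem prismParam_add [NeZero m] (hm : Even m) (hm3 : 3 ≤ m) (i : ZMod m) (a : Fin 3) :
    prismParam (i, a) + prismParam (i + 1, a) = 5 * (i.val : ℝ) + 5 * ((i + 1).val : ℝ) := by
  have hsign : (-1 : ℝ) ^ (i + 1).val = - (-1) ^ i.val := by
    have h1 : (1 : ZMod m).val = 1 := by
      have : Fact (1 < m) := ⟨by omega⟩
      exact ZMod.val_one m
    have hlt := ZMod.val_lt i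
    rw [ZMod.val_add, h1]
    rcases Nat.lt_or_ge (i.val + 1) m with h | h
    · rw [Nat.mod_eq_of_lt h, pow_succ]; ring
    · have h2 : i.val + 1 = m := by omega
      have h3 : Odd i.val := by
        rw [← h2, Nat.even_add_one, Nat.not_even_iff_odd] at hm
        exact hm
      rw [h2, Nat.mod_self, pow_zero, h3.neg_one_pow, neg_neg]
  simp only [prismParam, hsign]
  ring

/-- Translating the triangles independently gives `2 m` dimensions of velocities; since the links
between two consecutive triangles are parallel, they impose a single condition. -/
theorem rigidityRank_ringThree_le [NeZero m] (hm : Even m) (hm3 : 3 ≤ m) :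
    rigidityRank (ringThree m) (parabola prismParam) ≤ 5 * m := by
  let Φ : (ZMod m × Fin 2 → ℝ) →ₗ[ℝ] ((ZMod m × Fin 3) × Fin 2 → ℝ) :=
    { toFun := fun w c => w (c.1.1, c.2)
      map_add' := fun a b => rfl
      map_smul' := fun t a => rfl }
  let Ψ : (ZMod m × Fin 2 → ℝ) →ₗ[ℝ] (ZMod m → ℝ) :=
    { toFun := fun w i => (w (i, 0) - w (i + 1, 0)) +
        (5 * (i.val : ℝ) + 5 * ((i + 1).val : ℝ)) * (w (i, 1) - w (i + 1, 1))
      map_add' := fun a b => by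
        funext i
        simp only [Pi.add_apply]
        ring
      map_smul' := fun t a => by
        funext i
        simp only [Pi.smul_apply, smul_eq_mul, RingHom.id_apply]
        ring }
  have h := rigidityRank_add_card_le (G := ringThree m) (p := parabola prismParam) Φ Ψ ?_ ?_
  · simp only [Fintype.card_prod, ZMod.card, Fintype.card_fin] at h
    omega
  · intro w hw
    funext ⟨i, j⟩
    exact congrFun hw ((i, 0), j)
  · intro w hw x y hxy
    refine ringGraph_adj_induction (P := fun x y => ∑ i, (parabola prismParam x i -
      parabola prismParam y i) * (Φ w (x, i) - Φ w (y, i)) = 0) ?_ ?_ ?_ hxy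
    · intro x y h
      rw [← h]
      exact Finset.sum_congr rfl fun i _ => by ring
    · intro i a b
      simp [Φ]
    · intro i c
      have h1 : (w (i, 0) - w (i + 1, 0)) +
          (5 * (i.val : ℝ) + 5 * ((i + 1).val : ℝ)) * (w (i, 1) - w (i + 1, 1)) = 0 :=
        congrFun hw i
      rw [← prismParam_add hm hm3 i c] at h1
      simp only [Fin.sum_univ_two, parabola, Φ, LinearMap.coe_mk, AddHom.coe_mk, id]
      simp
      linear_combination (prismParam (i, c) - prismParam (i + 1, c)) * h1

end Families

/-! ### Relabelling the vertices -/

section Relabel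

variable {V W : Type*}

theorem isFourValent_comap [Fintype V] [Fintype W] {G : SimpleGraph V} (e : W ≃ V)
    (hG : IsFourValent G) : IsFourValent (G.comap e) := by
  classical
  refine isFourValent_of_card_filter fun x => ?_
  rw [← degIn_univ_of_isFourValent hG (e x), degIn]
  refine Finset.card_bij (fun y _ => e y) ?_ ?_ ?_
  · intro y hy
    simpa using hy
  · intro y _ z _ h
    exact e.injective h
  · intro y hy
    exact ⟨e.symm y, by simpa using hy, by simp⟩

theorem isVertexConnected_comap {G : SimpleGraph V} (e : W ≃ V) {k : ℕ}
    (hG : IsVertexConnected G k) : IsVertexConnected (G.comap e) k := by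
  intro U hU x y
  have hmem (v : W) : e v ∉ U.map e.toEmbedding ↔ v ∉ U := by simp
  have h := hG (U.map e.toEmbedding) (by rwa [Finset.card_map]) ⟨e x, (hmem _).mpr x.2⟩
    ⟨e y, (hmem _).mpr y.2⟩
  let f : G.induce {v | v ∉ U.map e.toEmbedding} →g (G.comap e).induce {v | v ∉ U} :=
    { toFun := fun v => ⟨e.symm v.1, (hmem _).mp (by simpa using v.2)⟩
      map_rel' := fun {a b} hab => by
        change G.Adj (e (e.symm a.1)) (e (e.symm b.1))
        rw [e.apply_symm_apply, e.apply_symm_apply]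
        exact hab }
  have h' := h.map f
  convert h' using 1
  · exact Subtype.ext (e.symm_apply_apply x.1).symm
  · exact Subtype.ext (e.symm_apply_apply y.1).symm

theorem rigidityRank_comap_le [Fintype V] [Fintype W] (G : SimpleGraph V) (e : W ≃ V)
    (p : Configuration V) : rigidityRank (G.comap e) (p ∘ e) ≤ rigidityRank G p := by
  classical
  let f : (G.comap e).edgeSet → G.edgeSet := fun d => ⟨d.1.map e, by
    obtain ⟨d, hd⟩ := d
    induction d with
    | h a b => exact hd⟩
  have h : rigidityMatrix (G.comap e) (p ∘ e) =
      (rigidityMatrix G p).submatrix f (e.prodCongr (Equiv.refl (Fin 2))) := by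
    ext ⟨d, hd⟩ ⟨w, i⟩
    induction d with
    | h a b => simp [rigidityMatrix, rigidityEntry, f]
  rw [rigidityRank, h]
  exact Matrix.rank_submatrix_le _ _ _

theorem rigidityRank_comap_ringGraph_le {m k r : ℕ} [NeZero m] [Fintype W]
    {B : Fin k → Fin k → Prop} {src tgt : Fin r → Fin k} (e : W ≃ ZMod m × Fin k)
    {p : Configuration W} (hp : Function.Injective p) (hk : 2 ≤ k) :
    rigidityRank ((ringGraph m B src tgt).comap e) p + 3 * m ≤ 2 * (m * k) + m * r := by
  have h := rigidityRank_comap_le (ringGraph m B src tgt) e (p ∘ e.symm)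
  rw [Function.comp_assoc, e.symm_comp_self, Function.comp_id] at h
  exact (Nat.add_le_add_right h _).trans
    (rigidityRank_ringGraph_le (hp.comp e.symm.injective) hk)

theorem rigidityRank_comap_ringFive_le {m : ℕ} [NeZero m] [Fintype W] (e : W ≃ ZMod m × Fin 5)
    {p : Configuration W} (hp : Function.Injective p) :
    rigidityRank ((ringFive m).comap e) p ≤ 8 * m := by
  have : rigidityRank ((ringFive m).comap e) p + 3 * m ≤ 2 * (m * 5) + m * 1 :=
    rigidityRank_comap_ringGraph_le e hp (by norm_num)
  omega

theorem rigidityRank_comap_ringFour_le {m : ℕ} [NeZero m] [Fintype W] (e : W ≃ ZMod m × Fin 4)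
    {p : Configuration W} (hp : Function.Injective p) :
    rigidityRank ((ringFour m).comap e) p ≤ 7 * m := by
  have : rigidityRank ((ringFour m).comap e) p + 3 * m ≤ 2 * (m * 4) + m * 2 :=
    rigidityRank_comap_ringGraph_le e hp (by norm_num)
  omega

theorem IsVertexConnected.mono {G : SimpleGraph V} {k l : ℕ} (h : IsVertexConnected G l)
    (hkl : k ≤ l) : IsVertexConnected G k :=
  fun U hU => h U (hU.trans_le hkl)

end Relabel

end FrameworkRank

open FrameworkRank in
theorem mainTheorem5 :
    -- the lower bounds
    (∀ {V : Type*} [Fintype V] (G : SimpleGraph V) (p : Configuration V),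
      IsFourValent G → InGeneralPosition p →
        (IsVertexConnected G 2 →
          (genericRank G : ℝ) ≥ rigidityRank G p ∧
          (rigidityRank G p : ℝ) ≥ 8 / 5 * (Fintype.card V : ℝ) - 1) ∧
        (IsVertexConnected G 3 ∨ IsVertexConnected G 4 →
          (genericRank G : ℝ) ≥ (7 * (Fintype.card V : ℝ) - 7) / 4 ∧
          (rigidityRank G p : ℝ) ≥ (5 * (Fintype.card V : ℝ) - 4) / 3)) ∧
    -- the order of each bound is sharp: the leading term is attained by arbitrarily large graphs
    (∀ N : ℕ, ∃ n ≥ N, ∃ G : SimpleGraph (Fin n),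
      IsFourValent G ∧ IsVertexConnected G 2 ∧ (genericRank G : ℝ) ≤ 8 / 5 * (n : ℝ)) ∧
    (∀ N : ℕ, ∃ n ≥ N, ∃ (G : SimpleGraph (Fin n)) (p : Configuration (Fin n)),
      IsFourValent G ∧ InGeneralPosition p ∧ IsVertexConnected G 2 ∧
        (rigidityRank G p : ℝ) ≤ 8 / 5 * (n : ℝ)) ∧
    (∀ k : ℕ, k = 3 ∨ k = 4 → ∀ N : ℕ, ∃ n ≥ N, ∃ G : SimpleGraph (Fin n),
      IsFourValent G ∧ IsVertexConnected G k ∧ (genericRank G : ℝ) ≤ 7 / 4 * (n : ℝ)) ∧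
    (∀ k : ℕ, k = 3 ∨ k = 4 → ∀ N : ℕ, ∃ n ≥ N,
      ∃ (G : SimpleGraph (Fin n)) (p : Configuration (Fin n)),
        IsFourValent G ∧ InGeneralPosition p ∧ IsVertexConnected G k ∧
          (rigidityRank G p : ℝ) ≤ 5 / 3 * (n : ℝ)) := by
  refine ⟨fun {V} _ G p hG hp => ⟨fun hconn => ⟨?_, ?_⟩, fun hconn => ?_⟩, fun N => ?_, fun N => ?_,
    fun k hk N => ?_, fun k hk N => ?_⟩
  · exact_mod_cast (exists_isGeneric V).choose_spec.rigidityRank_le G p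
  · have h1 := card_edgeFinset_eq_rigidityRank_add (G := G) p
    rw [card_edgeFinset_of_isFourValent hG] at h1
    have h2 := five_mul_finrank_stressIn_univ_le hp hG
      fun X hn hne => hconn.cutCard_pos (by norm_num) hn hne
    have h3 : 8 * Fintype.card V ≤ 5 * rigidityRank G p + 5 := by omega
    have h4 : (8 : ℝ) * Fintype.card V ≤ 5 * rigidityRank G p + 5 := by exact_mod_cast h3
    linarith
  · rcases isEmpty_or_nonempty V with hE | hV
    · have h0 : (Fintype.card V : ℝ) = 0 := by exact_mod_cast Fintype.card_eq_zero
      have h1 : (0 : ℝ) ≤ genericRank G := Nat.cast_nonneg _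
      have h2 : (0 : ℝ) ≤ rigidityRank G p := Nat.cast_nonneg _
      rw [h0]
      constructor <;> linarith
    · have hC := IsVertexConnected.isThreeEdgeConnectedOn_univ hG
        (hconn.elim id fun h => h.mono (by norm_num))
      constructor
      · have hq := (exists_isGeneric V).choose_spec
        have h1 := card_edgeFinset_eq_rigidityRank_add (G := G) (exists_isGeneric V).choose
        rw [card_edgeFinset_of_isFourValent hG] at h1
        have h2 := four_mul_finrank_stressIn_univ_le hq hG hC
        have h3 : 7 * Fintype.card V ≤ 4 * genericRank G + 7 := by
          rw [genericRank]
          omega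
        have h4 : (7 : ℝ) * Fintype.card V ≤ 4 * genericRank G + 7 := by exact_mod_cast h3
        linarith
      · have h1 := card_edgeFinset_eq_rigidityRank_add (G := G) p
        rw [card_edgeFinset_of_isFourValent hG] at h1
        have h2 := three_mul_finrank_stressIn_univ_le hp hG hC
        have h3 : 5 * Fintype.card V ≤ 3 * rigidityRank G p + 4 := by omega
        have h4 : (5 : ℝ) * Fintype.card V ≤ 3 * rigidityRank G p + 4 := by exact_mod_cast h3
        linarith
  · let m := N + 3
    have hcard : Fintype.card (ZMod m × Fin 5) = m * 5 := by simp [ZMod.card]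
    let e : Fin (m * 5) ≃ ZMod m × Fin 5 := (Fintype.equivFinOfCardEq hcard).symm
    refine ⟨m * 5, by omega, (ringFive m).comap e,
      isFourValent_comap e (isFourValent_ringFive (by omega)),
      isVertexConnected_comap e (isVertexConnected_ringFive (by omega)), ?_⟩
    have hq := (exists_isGeneric (Fin (m * 5))).choose_spec
    have h3 : genericRank ((ringFive m).comap e) ≤ 8 * m :=
      rigidityRank_comap_ringFive_le e hq.injective
    have h4 : (genericRank ((ringFive m).comap e) : ℝ) ≤ 8 * m := by exact_mod_cast h3
    push_cast
    linarith
  · let m := N + 3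
    have hcard : Fintype.card (ZMod m × Fin 5) = m * 5 := by simp [ZMod.card]
    let e : Fin (m * 5) ≃ ZMod m × Fin 5 := (Fintype.equivFinOfCardEq hcard).symm
    have ht : Function.Injective fun i : Fin (m * 5) => (i.val : ℝ) :=
      Nat.cast_injective.comp Fin.val_injective
    refine ⟨m * 5, by omega, (ringFive m).comap e, parabola fun i => (i.val : ℝ),
      isFourValent_comap e (isFourValent_ringFive (by omega)), inGeneralPosition_parabola ht,
      isVertexConnected_comap e (isVertexConnected_ringFive (by omega)), ?_⟩
    have h3 := rigidityRank_comap_ringFive_le e (injective_parabola ht)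
    have h4 : (rigidityRank ((ringFive m).comap e) (parabola fun i => (i.val : ℝ)) : ℝ) ≤
      8 * m := by exact_mod_cast h3
    push_cast
    linarith
  · let m := N + 3
    have hcard : Fintype.card (ZMod m × Fin 4) = m * 4 := by simp [ZMod.card]
    let e : Fin (m * 4) ≃ ZMod m × Fin 4 := (Fintype.equivFinOfCardEq hcard).symm
    refine ⟨m * 4, by omega, (ringFour m).comap e,
      isFourValent_comap e (isFourValent_ringFour (by omega)),
      isVertexConnected_comap e ((isVertexConnected_ringFour (by omega)).mono (by omega)), ?_⟩
    have hq := (exists_isGeneric (Fin (m * 4))).choose_spec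
    have h3 : genericRank ((ringFour m).comap e) ≤ 7 * m :=
      rigidityRank_comap_ringFour_le e hq.injective
    have h4 : (genericRank ((ringFour m).comap e) : ℝ) ≤ 7 * m := by exact_mod_cast h3
    push_cast
    linarith
  · let m := 2 * (N + 2)
    have : NeZero m := ⟨by omega⟩
    have hm : Even m := even_two_mul _
    have hcard : Fintype.card (ZMod m × Fin 3) = m * 3 := by simp [ZMod.card]
    let e : Fin (m * 3) ≃ ZMod m × Fin 3 := (Fintype.equivFinOfCardEq hcard).symm
    refine ⟨m * 3, by omega, (ringThree m).comap e, parabola prismParam ∘ e,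
      isFourValent_comap e (isFourValent_ringThree (by omega)),
      inGeneralPosition_parabola (injective_prismParam.comp e.injective),
      isVertexConnected_comap e ((isVertexConnected_ringThree (by omega)).mono (by omega)), ?_⟩
    have h3 := (rigidityRank_comap_le (ringThree m) e (parabola prismParam)).trans
      (rigidityRank_ringThree_le hm (by omega))
    have h4 : (rigidityRank ((ringThree m).comap e) (parabola prismParam ∘ e) : ℝ) ≤ 5 * m := by
      exact_mod_cast h3
    rw [Nat.cast_mul]
    push_cast at h4 ⊢
    linarith
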